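/- **Setting.** Let $M$ be $\mathbb R$, $\mathbb T^1=\mathbb R/\mathbb Z$ or $I=[-1,1]$, and let $f:M\to M$ be a $C^2$ map. If $M=I$, assume moreover that for some $a>0$ the map $f$ is defined and $C^2$ on $[-1-a,1+a]$ and $f([-1-a,1+a])\subset I$. If $M=\mathbb T^1$, derivatives of iterates, the orbits and the difference $x_n-f^n(x)$ below are computed for a $C^2$ lift of $f$ to $\mathbb R$. Put $\|f''\|_{C_0}=\sup_{x\in M}|f''(x)|\in[0,\infty]$. Let $p>2$ and let $(\xi_j)_{j\ge1}$ be independent real random variables on a probability space $(\Omega,\mathcal F,\mathbb P)$ with $\mathbb E[\xi_j]=0$ and $c\le\|\xi_j\|_2\le\|\xi_j\|_p\le C$ for all $j$, with constants $0<c\le C<\infty$, where $\|\xi\|_s=(\mathbb E|\xi|^s)^{1/s}$. For $x\in M$, $\sigma>0$ let $x_0=x$ and $x_m=f(x_{m-1})+\sigma\xi_m$, and write $x_n(x,\sigma)=x_n$. If $M=I$, $x_n(x,\sigma)$ is considered on the event $G_n(\sigma)=\{\sigma\max_{1\le j\le n}|\xi_j|\le a\}$ only, and is extended to $\Omega$ as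 an arbitrary random variable; if $M\ne I$ put $G_n(\sigma)=\Omega$. Let $$\Lambda_s(x,n)=\sum_{j=1}^n\bigl|(f^{n-j})'(f^j(x))\bigr|^s,\qquad \widehat\Lambda(x,n)=\max_{0\le i\le n}\sum_{j=0}^i\bigl|(f^{i-j})'(f^j(x))\bigr|,\qquad L_n(x)=\sum_{j=1}^n (f^{n-j})'(f^j(x))\,\xi_j .$$ **Theorem.** Suppose that for some $x\in M$ there is an increasing sequence of positive integers $n_k$ with $$\lim_{k\to\infty}\frac{\Lambda_p(x,n_k)}{\Lambda_2(x,n_k)^{p/2}}=0 .$$ Let $(\sigma_k)$ be a sequence of positive numbers, and assume that one of the following holds: * (H1) $\displaystyle\lim_{k\to\infty}\frac{\|f''\|_{C_0}\,\bigl\|\max_{1\le j\le n_k}|\xi_j|\bigr\|_p^2\,\widehat\Lambda(x,n_k)^6\,\sigma_k}{\sqrt{\Lambda_2(x,n_k)}}=0$; * (H2) $p\ge4$ and $\displaystyle\lim_{k\to\infty}\frac{\|f''\|_{C_0}\,\bigl\|\max_{1\le j\le n_k}|\xi_j|\bigr\|_p^2\,\widehat\Lambda(x,n_k)^3\,\sigma_k}{\sqrt{\Lambda_2(x,n_k)}}=0$.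 Then there are events $B_k\in\mathcal F$, $B_k\subset G_{n_k}(\sigma_k)$, such that $\lim_{k\to\infty}\mathbb P[B_k]=1$ and both $$w_k=\frac{x_{n_k}(x,\sigma_k)-f^{n_k}(x)}{\sigma_k\sqrt{\operatorname{var}[L_{n_k}(x)]}}\qquad\text{and}\qquad \widetilde w_k=\frac{(x_{n_k}(x,\sigma_k)-f^{n_k}(x))\mathbf 1_{B_k}}{\sqrt{\operatorname{var}[(x_{n_k}(x,\sigma_k)-f^{n_k}(x))\mathbf 1_{B_k}]}}$$ converge in distribution to a standard Gaussian as $k\to\infty$. Furthermore, if all $\xi_j$ are almost surely supported on one common compact set, then the convergence of $w_k$ and $\widetilde w_k$ holds with $B_k=\Omega$ for all $k$. -/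

import Mathlib

open MeasureTheory ProbabilityTheory Filter Topology

/-- A `C²` map `f` of one of the spaces `M = ℝ`, `M = 𝕋¹ = ℝ/ℤ` or `M = I = [-1,1]`.

* `line`: a `C²` map of `ℝ`.
* `circle`: a map `f` of `ℝ/ℤ`, which is `C²` in the sense that it has a `C²` lift `F : ℝ → ℝ`.
* `interval`: a map that is `C²` on the larger interval `[-1-a,1+a]`, `a > 0`, and sends it
  into `[-1,1]`; the values of `f` outside `[-1-a,1+a]` are irrelevant. -/
inductive WeakNoiseMap : Type
  | line (f : ℝ → ℝ) (smooth : ContDiff ℝ 2 f) : WeakNoiseMap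
  | circle (f : UnitAddCircle → UnitAddCircle) (F : ℝ → ℝ) (smooth : ContDiff ℝ 2 F)
      (lifts : ∀ t : ℝ, f (t : UnitAddCircle) = (F t : UnitAddCircle)) : WeakNoiseMap
  | interval (f : ℝ → ℝ) (a : ℝ) (a_pos : 0 < a)
      (smooth : ContDiffOn ℝ 2 f (Set.Icc (-1 - a) (1 + a)))
      (maps : Set.MapsTo f (Set.Icc (-1 - a) (1 + a)) (Set.Icc (-1) 1)) : WeakNoiseMap

/-- The map written in the coordinate of `M` (for the circle: the lift to `ℝ`). -/
def WeakNoiseMap.coord : WeakNoiseMap → ℝ → ℝ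
  | .line f _ => f
  | .circle _ F _ _ => F
  | .interval f _ _ _ _ => f

/-- The coordinates of the points of `M` (for the circle: all representatives in `ℝ`). -/
def WeakNoiseMap.space : WeakNoiseMap → Set ℝ
  | .line _ _ => Set.univ
  | .circle _ _ _ _ => Set.univ
  | .interval _ _ _ _ _ => Set.Icc (-1) 1

/-- `‖f''‖_{C₀} = sup_{x ∈ M} |f''(x)|`, as an extended nonnegative number (it may be infinite
for `M = ℝ`). -/
noncomputable def WeakNoiseMap.secondDerivSup (S : WeakNoiseMap) : ENNReal :=
  ⨆ x ∈ S.space, ENNReal.ofReal |deriv (deriv S.coord) x|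

/-- `Λ_s(x,n) = ∑_{j=1}^n |(g^{n-j})'(g^j(x))|^s`. -/
noncomputable def lyapunovSum (g : ℝ → ℝ) (s x : ℝ) (n : ℕ) : ℝ :=
  ∑ j ∈ Finset.Icc 1 n, |deriv (g^[n - j]) (g^[j] x)| ^ s

/-- `Λ̂(x,n) = max_{0 ≤ i ≤ n} ∑_{j=0}^i |(g^{i-j})'(g^j(x))|`. -/
noncomputable def lyapunovHat (g : ℝ → ℝ) (x : ℝ) (n : ℕ) : ℝ :=
  (Finset.range (n + 1)).sup' Finset.nonempty_range_add_one
    fun i => ∑ j ∈ Finset.range (i + 1), |deriv (g^[i - j]) (g^[j] x)|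

/-- The noisy orbit `x_0 = x`, `x_m = g(x_{m-1}) + σ ξ_m`, for one realization `ξ` of the noise. -/
def noisyOrbit (g : ℝ → ℝ) (σ : ℝ) (ξ : ℕ → ℝ) (x : ℝ) : ℕ → ℝ
  | 0 => x
  | m + 1 => g (noisyOrbit g σ ξ x m) + σ * ξ (m + 1)

/-- The noisy orbit on the circle: `x_0 = x`, `x_m = f(x_{m-1}) + σ ξ_m mod 1`. -/
def circleNoisyOrbit (f : UnitAddCircle → UnitAddCircle) (σ : ℝ) (ξ : ℕ → ℝ)
    (x : UnitAddCircle) : ℕ → UnitAddCircle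
  | 0 => x
  | m + 1 => f (circleNoisyOrbit f σ ξ x m) + ((σ * ξ (m + 1) : ℝ) : UnitAddCircle)

/-- The noisy orbit of a lift is a lift of the noisy orbit on the circle. -/
theorem coe_noisyOrbit (f : UnitAddCircle → UnitAddCircle) (F : ℝ → ℝ)
    (lifts : ∀ t : ℝ, f (t : UnitAddCircle) = (F t : UnitAddCircle))
    (σ : ℝ) (ξ : ℕ → ℝ) (x : ℝ) (m : ℕ) :
    ((noisyOrbit F σ ξ x m : ℝ) : UnitAddCircle)
      = circleNoisyOrbit f σ ξ (x : UnitAddCircle) m := by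
  induction m with
  | zero => rfl
  | succ m ih => rw [noisyOrbit, circleNoisyOrbit, ← ih, lifts, AddCircle.coe_add]

section Noise

variable {Ω : Type*}

/-- `max_{1 ≤ j ≤ n} |ξ_j|`. -/
noncomputable def noiseMax (ξ : ℕ → Ω → ℝ) (n : ℕ) (ω : Ω) : ℝ :=
  ((Finset.Icc 1 n).sup fun j => ‖ξ j ω‖₊ : NNReal)

/-- The linearized effective noise `L_n(x) = ∑_{j=1}^n (g^{n-j})'(g^j(x)) ξ_j`. -/
noncomputable def linearNoise (g : ℝ → ℝ) (ξ : ℕ → Ω → ℝ) (x : ℝ) (n : ℕ) (ω : Ω) : ℝ :=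
  ∑ j ∈ Finset.Icc 1 n, deriv (g^[n - j]) (g^[j] x) * ξ j ω

/-- The event on which `x_n(x,σ)` is considered: everything for `M = ℝ` and `M = 𝕋¹`, and the event
`{σ max_{1≤j≤n} |ξ_j| ≤ a}` for `M = I`. -/
def WeakNoiseMap.admissible (S : WeakNoiseMap) (ξ : ℕ → Ω → ℝ) (σ : ℝ) (n : ℕ) : Set Ω :=
  match S with
  | .line _ _ => Set.univ
  | .circle _ _ _ _ => Set.univ
  | .interval _ a _ _ _ => {ω | σ * noiseMax ξ n ω ≤ a}

variable [MeasurableSpace Ω]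

/-- The random variable `X` is the process value `x_n(x,σ)`, wherever the latter is considered. -/
def WeakNoiseMap.IsProcessValue (S : WeakNoiseMap) (P : Measure Ω) (ξ : ℕ → Ω → ℝ) (x σ : ℝ)
    (n : ℕ) (X : Ω → ℝ) : Prop :=
  AEMeasurable X P ∧
    ∀ ω ∈ S.admissible ξ σ n, X ω = noisyOrbit S.coord σ (fun j => ξ j ω) x n

/-- Convergence in distribution, for outlier-free events `B_k`, of the effective noise in both
normalizations: by the standard deviation of the linearized noise, and, after restriction
to `B_k`, by its own standard deviation. -/
def WeakNoiseMap.EffectiveNoiseCLT (S : WeakNoiseMap) (P : Measure Ω) [IsProbabilityMeasure P]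
    (ξ : ℕ → Ω → ℝ) (x : ℝ) (n : ℕ → ℕ) (σ : ℕ → ℝ) (B : ℕ → Set Ω) : Prop :=
  ∀ X : ℕ → Ω → ℝ, (∀ k, S.IsProcessValue P ξ x (σ k) (n k) (X k)) →
    TendstoInDistribution
      (fun k ω => (X k ω - S.coord^[n k] x) /
        (σ k * √(variance (linearNoise S.coord ξ x (n k)) P)))
      atTop (id : ℝ → ℝ) (fun _ => P) (gaussianReal 0 1) ∧
    TendstoInDistribution
      (fun k ω => (B k).indicator (fun ω' => X k ω' - S.coord^[n k] x) ω /
        √(variance ((B k).indicator (fun ω' => X k ω' - S.coord^[n k] x)) P))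
      atTop (id : ℝ → ℝ) (fun _ => P) (gaussianReal 0 1)

/-- The weak noise condition with exponent `q`:
`‖f''‖_{C₀} ‖max_{1≤j≤n_k} |ξ_j|‖_p² Λ̂(x,n_k)^q σ_k / √Λ₂(x,n_k) → 0`. -/
def WeakNoiseMap.WeakNoise (S : WeakNoiseMap) (P : Measure Ω) (ξ : ℕ → Ω → ℝ) (p x : ℝ)
    (n : ℕ → ℕ) (σ : ℕ → ℝ) (q : ℕ) : Prop :=
  Tendsto (fun k => S.secondDerivSup
      * eLpNorm (noiseMax ξ (n k)) (ENNReal.ofReal p) P ^ 2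
      * ENNReal.ofReal (lyapunovHat S.coord x (n k) ^ q * σ k
          / √(lyapunovSum S.coord 2 x (n k))))
    atTop (𝓝 0)

end Noise

/-! With `Δ_m = x_m - f^m(x)`, Taylor expansion gives `Δ_{m+1} = f'(f^m x) Δ_m + σ ξ_{m+1} + R_m`
with `|R_m| ≤ H Δ_m²`. Variation of constants turns this into `Δ_n = σ L_n` plus a weighted sum of
the `R_m`. If `M` bounds the noise and `H Λ̂² σ M ≤ 1/4`, a bootstrap gives `|Δ_m| ≤ 2 Λ̂ σ M` at
all times up to `n`, hence `|Δ_n - σ L_n| ≤ 4 H Λ̂³ (σ M)²` (`abs_noisyOrbit_sub_sub_le`).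

Relative to `σ √Λ₂` this error is the weak noise quantity with exponent 3, with `M` in place of the
`L^p` norm of the maximum. Taking `M = T_k ‖max |ξ_j|‖_p` with `T_k → ∞` slowly keeps the error
null, while Markov's inequality makes the event `max |ξ_j| ≤ M` asymptotically certain
(`exists_outlier_free_events`).

The normalized linear noise is a sum of independent terms whose Lyapunov ratio is at most a constant
times `Λ_p / Λ₂^{p/2}`, so it is asymptotically Gaussian (`tendstoInDistribution_linearNoise`), and
so is everything close to it in probability. For the second normalization the variances must
converge too: the normalized linear noise has second moment 1, as does its limit, so no mass escapes
and its squares are negligible off `B_k` (`tendsto_setIntegral_compl_sq`).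

On the interval the noisy orbit may leave `[-1,1]`, where `‖f''‖` says nothing. A bound on a larger
interval is still a multiple of `‖f''‖`, because `‖f''‖ = 0` would contradict the Lyapunov
condition. -/

/-! ### Lyapunov's central limit theorem by characteristic functions. -/

theorem norm_exp_I_mul_sub_taylor_two_le (x : ℝ) :
    ‖Complex.exp (Complex.I * x) - (1 + Complex.I * x - (x : ℂ) ^ 2 / 2)‖
      ≤ min (3 * x ^ 2) (3 * |x| ^ 3) := by
  have hnx : ‖Complex.I * (x : ℂ)‖ = |x| := by simp
  rcases le_total |x| 1 with hx | hx
  · have h := Complex.exp_bound (x := Complex.I * x) (by rw [hnx]; exact hx) (n := 3) (by norm_num)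
    rw [hnx] at h
    have e : ∑ m ∈ Finset.range 3, (Complex.I * (x : ℂ)) ^ m / (m.factorial : ℂ)
        = 1 + Complex.I * x - (x : ℂ) ^ 2 / 2 := by
      simp [Finset.sum_range_succ, mul_pow]
      ring
    rw [e] at h
    have h0 : 0 ≤ |x| ^ 3 := by positivity
    have h3 : ‖Complex.exp (Complex.I * x) - (1 + Complex.I * x - (x : ℂ) ^ 2 / 2)‖ ≤ |x| ^ 3 := by
      refine h.trans ?_
      norm_num [Nat.factorial]
      nlinarith
    have h2 : |x| ^ 3 ≤ x ^ 2 := by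
      rw [← sq_abs x]
      nlinarith [sq_nonneg |x|]
    refine le_min (by nlinarith) (by nlinarith)
  · have h1 : ‖Complex.exp (Complex.I * x) - (1 + Complex.I * x - (x : ℂ) ^ 2 / 2)‖
        ≤ |x| + |x| + x ^ 2 / 2 := by
      have e : Complex.exp (Complex.I * x) - (1 + Complex.I * x - (x : ℂ) ^ 2 / 2)
          = (Complex.exp (Complex.I * x) - 1) - Complex.I * x + (x : ℂ) ^ 2 / 2 := by ring
      rw [e]
      refine (norm_add_le _ _).trans (add_le_add ((norm_sub_le _ _).trans (add_le_add ?_ ?_)) ?_)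
      · exact Real.norm_exp_I_mul_ofReal_sub_one_le
      · rw [hnx]
      · simp
    have h2 : |x| ≤ x ^ 2 := by rw [← sq_abs x]; nlinarith
    have h3 : x ^ 2 ≤ |x| ^ 3 := by rw [← sq_abs x]; nlinarith [sq_nonneg |x|]
    refine le_min (by nlinarith) (by nlinarith)

/-- A square is dominated by `ε²` and a higher power. -/
theorem sq_le_rpow_of_le {p ε x : ℝ} (hp : 2 < p) (hε : 0 < ε) (hx : ε ≤ |x|) :
    x ^ 2 ≤ ε ^ (2 - p) * |x| ^ p := by
  have hx0 : 0 < |x| := hε.trans_le hx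
  have h1 : |x| ^ (2 - p) ≤ ε ^ (2 - p) := Real.rpow_le_rpow_of_nonpos hε hx (by linarith)
  calc x ^ 2 = |x| ^ (2 : ℝ) := by simp
    _ = |x| ^ (2 - p) * |x| ^ p := by rw [← Real.rpow_add hx0]; ring_nf
    _ ≤ _ := by gcongr

/-- Below `ε` the cubic bound is used, above it the quadratic one. The cut treats all `p > 2` alike,
including `p < 3`; the large factor `ε ^ (2 - p)` is harmless since it multiplies the Lyapunov sum.
-/
theorem norm_exp_I_mul_sub_taylor_two_le_rpow {p ε : ℝ} (hp : 2 < p) (hε : 0 < ε) (x : ℝ) :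
    ‖Complex.exp (Complex.I * x) - (1 + Complex.I * x - (x : ℂ) ^ 2 / 2)‖
      ≤ 3 * (ε * x ^ 2 + ε ^ (2 - p) * |x| ^ p) := by
  have h := norm_exp_I_mul_sub_taylor_two_le x
  have hA : 0 ≤ ε ^ (2 - p) * |x| ^ p := by positivity
  have hB : 0 ≤ ε * x ^ 2 := by positivity
  rcases le_total |x| ε with hx | hx
  · have : |x| ^ 3 ≤ ε * x ^ 2 := by
      rw [← sq_abs x, pow_succ']
      gcongr
    linarith [h.trans (min_le_right _ _)]
  · linarith [h.trans (min_le_left _ _), sq_le_rpow_of_le hp hε hx]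

/-- Factors are exchanged one at a time; those left in place lie in the unit disc and do not amplify
the error. -/
theorem norm_prod_sub_prod_le_sum {ι : Type*} (s : Finset ι) (a b : ι → ℂ)
    (ha : ∀ i ∈ s, ‖a i‖ ≤ 1) (hb : ∀ i ∈ s, ‖b i‖ ≤ 1) :
    ‖∏ i ∈ s, a i - ∏ i ∈ s, b i‖ ≤ ∑ i ∈ s, ‖a i - b i‖ := by
  classical
  induction s using Finset.induction_on with
  | empty => simp
  | insert i s hi ih =>
    rw [Finset.prod_insert hi, Finset.prod_insert hi, Finset.sum_insert hi]
    have e : a i * ∏ i ∈ s, a i - b i * ∏ i ∈ s, b i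
        = (a i - b i) * ∏ i ∈ s, a i + b i * (∏ i ∈ s, a i - ∏ i ∈ s, b i) := by ring
    rw [e]
    refine (norm_add_le _ _).trans ?_
    rw [norm_mul, norm_mul]
    have h1 : ‖∏ i ∈ s, a i‖ ≤ 1 := by
      rw [norm_prod]
      exact Finset.prod_le_one (fun _ _ => norm_nonneg _)
        fun j hj => ha j (Finset.mem_insert_of_mem hj)
    have h2 := hb i (Finset.mem_insert_self _ _)
    have h3 := ih (fun j hj => ha j (Finset.mem_insert_of_mem hj))
      (fun j hj => hb j (Finset.mem_insert_of_mem hj))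
    have := norm_nonneg (a i - b i)
    have := norm_nonneg (∏ i ∈ s, a i - ∏ i ∈ s, b i)
    have := norm_nonneg (∏ i ∈ s, a i)
    nlinarith

theorem abs_exp_neg_sub_one_sub_le {u : ℝ} (hu : 0 ≤ u) :
    |Real.exp (-u) - (1 - u)| ≤ u ^ 2 := by
  rcases le_total u 1 with h | h
  · have := Real.abs_exp_sub_one_sub_id_le (x := -u) (by rw [abs_neg, abs_of_nonneg hu]; exact h)
    rw [neg_sq] at this
    convert this using 2
    ring
  · have h1 := Real.one_sub_le_exp_neg u
    have h2 : Real.exp (-u) ≤ 1 := Real.exp_le_one_iff.2 (by linarith)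
    rw [abs_of_nonneg (by linarith)]
    nlinarith

section CLT

variable {Ω : Type*} [MeasurableSpace Ω] {P : Measure Ω} [IsProbabilityMeasure P]

theorem norm_charFun_sub_taylor_two_le {p ε : ℝ} (hp : 2 < p) (hε : 0 < ε) {X : Ω → ℝ}
    (hX : MemLp X (ENNReal.ofReal p) P) (h0 : ∫ ω, X ω ∂P = 0) (t : ℝ) :
    ‖charFun (P.map X) t - ((1 - t ^ 2 * (∫ ω, X ω ^ 2 ∂P) / 2 : ℝ) : ℂ)‖
      ≤ 3 * (ε * t ^ 2 * ∫ ω, X ω ^ 2 ∂P + ε ^ (2 - p) * |t| ^ p * ∫ ω, |X ω| ^ p ∂P) := by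
  have hm : AEMeasurable X P := hX.1.aemeasurable
  have hX2 : MemLp X 2 P := hX.mono_exponent (by
    rw [← ENNReal.ofReal_ofNat]; exact ENNReal.ofReal_le_ofReal hp.le)
  have hX1 : Integrable X P := hX2.integrable (by norm_num)
  have hi2 : Integrable (fun ω => X ω ^ 2) P := hX2.integrable_sq
  have hip : Integrable (fun ω => |X ω| ^ p) P := by
    have := hX.integrable_norm_rpow (by simp; linarith) (by simp)
    rwa [ENNReal.toReal_ofReal (by linarith)] at this
  have hie : Integrable (fun ω => Complex.exp (Complex.I * ((t * X ω : ℝ) : ℂ))) P := by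
    refine Integrable.of_bound (C := 1) (by fun_prop) (ae_of_all _ fun ω => ?_)
    rw [Complex.norm_exp_I_mul_ofReal]
  have hiT : Integrable (fun ω => (1 + Complex.I * ((t * X ω : ℝ) : ℂ)
      - ((t * X ω : ℝ) : ℂ) ^ 2 / 2)) P := by
    refine Integrable.sub (Integrable.add (integrable_const _) ?_) ?_
    · exact ((hX1.const_mul t).ofReal).const_mul _
    · have : Integrable (fun ω => (((t ^ 2 / 2) * X ω ^ 2 : ℝ) : ℂ)) P := (hi2.const_mul _).ofReal
      refine this.congr (ae_of_all _ fun ω => ?_)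
      push_cast
      ring
  have e : charFun (P.map X) t - ((1 - t ^ 2 * (∫ ω, X ω ^ 2 ∂P) / 2 : ℝ) : ℂ)
      = ∫ ω, (Complex.exp (Complex.I * ((t * X ω : ℝ) : ℂ)) - (1 + Complex.I * ((t * X ω : ℝ) : ℂ)
        - ((t * X ω : ℝ) : ℂ) ^ 2 / 2)) ∂P := by
    rw [integral_sub hie hiT]
    congr 1
    · rw [charFun_apply_real, integral_map hm (by fun_prop)]
      congr 1
      ext ω
      congr 1
      push_cast
      ring
    · have : ∀ ω, (1 + Complex.I * ((t * X ω : ℝ) : ℂ) - ((t * X ω : ℝ) : ℂ) ^ 2 / 2)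
          = ((1 - t ^ 2 / 2 * X ω ^ 2 : ℝ) : ℂ) + Complex.I * ((t * X ω : ℝ) : ℂ) := by
        intro ω; push_cast; ring
      simp_rw [this]
      rw [integral_add, integral_const_mul, integral_complex_ofReal, integral_complex_ofReal,
        integral_const_mul, h0, integral_sub, integral_const_mul]
      · simp; ring
      · exact integrable_const _
      · exact hi2.const_mul _
      · exact ((integrable_const _).sub (hi2.const_mul _)).ofReal
      · exact ((hX1.const_mul t).ofReal).const_mul _
  rw [e]
  have hib : Integrable (fun ω => 3 * (ε * (t * X ω) ^ 2 + ε ^ (2 - p) * |t * X ω| ^ p)) P := by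
    refine Integrable.const_mul (Integrable.add ?_ ?_) _
    · simp_rw [mul_pow]
      exact (hi2.const_mul _).const_mul _
    · simp_rw [abs_mul, Real.mul_rpow (abs_nonneg _) (abs_nonneg _)]
      exact (hip.const_mul _).const_mul _
  refine (norm_integral_le_of_norm_le hib (ae_of_all _ fun ω =>
    norm_exp_I_mul_sub_taylor_two_le_rpow hp hε _)).trans (le_of_eq ?_)
  simp_rw [mul_pow, abs_mul, Real.mul_rpow (abs_nonneg _) (abs_nonneg _)]
  rw [integral_const_mul, integral_add ((hi2.const_mul _).const_mul _)
    ((hip.const_mul _).const_mul _)]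
  simp_rw [integral_const_mul]
  ring

/-- Serves to show that each single variance in the array is small once the Lyapunov sum is. -/
theorem integral_sq_le_rpow {p ε : ℝ} (hp : 2 < p) (hε : 0 < ε) {X : Ω → ℝ}
    (hX : MemLp X (ENNReal.ofReal p) P) :
    ∫ ω, X ω ^ 2 ∂P ≤ ε ^ 2 + ε ^ (2 - p) * ∫ ω, |X ω| ^ p ∂P := by
  have hX2 : MemLp X 2 P := hX.mono_exponent (by
    rw [← ENNReal.ofReal_ofNat]; exact ENNReal.ofReal_le_ofReal hp.le)
  have hip : Integrable (fun ω => |X ω| ^ p) P := by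
    have := hX.integrable_norm_rpow (by simp; linarith) (by simp)
    rwa [ENNReal.toReal_ofReal (by linarith)] at this
  have : ε ^ 2 + ε ^ (2 - p) * ∫ ω, |X ω| ^ p ∂P
      = ∫ ω, (ε ^ 2 + ε ^ (2 - p) * |X ω| ^ p) ∂P := by
    rw [integral_add (integrable_const _) (hip.const_mul _), integral_const_mul]
    simp
  rw [this]
  refine integral_mono hX2.integrable_sq ((integrable_const _).add (hip.const_mul _)) fun ω => ?_
  have h0 : 0 ≤ ε ^ (2 - p) * |X ω| ^ p := by positivity
  rcases le_total |X ω| ε with h | h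
  · have : X ω ^ 2 ≤ ε ^ 2 := by rw [← sq_abs]; gcongr
    simp only
    linarith
  · have := sq_le_rpow_of_le hp hε h
    simp only
    nlinarith [sq_nonneg ε]

/-- The characteristic function of a normalized sum is close to the Gaussian one when the
Lyapunov sum is small. -/
theorem norm_charFun_sum_sub_gaussian_le {p ε : ℝ} (hp : 2 < p) (hε : 0 < ε)
    {X : ℕ → Ω → ℝ} (hX : ∀ i, MemLp (X i) (ENNReal.ofReal p) P) (hind : iIndepFun X P)
    (h0 : ∀ i, ∫ ω, X i ω ∂P = 0) (N : ℕ)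
    (h1 : ∑ i ∈ Finset.range N, ∫ ω, X i ω ^ 2 ∂P = 1) (t : ℝ) :
    ‖charFun (P.map fun ω => ∑ i ∈ Finset.range N, X i ω) t
        - ((Real.exp (-(t ^ 2 / 2)) : ℝ) : ℂ)‖
      ≤ (3 * ε * t ^ 2 + t ^ 4 * ε ^ 2) + (3 * ε ^ (2 - p) * |t| ^ p + t ^ 4 * ε ^ (2 - p))
        * ∑ i ∈ Finset.range N, ∫ ω, |X i ω| ^ p ∂P := by
  set S := ∑ i ∈ Finset.range N, ∫ ω, |X i ω| ^ p ∂P with hS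
  set v : ℕ → ℝ := fun i => ∫ ω, X i ω ^ 2 ∂P with hv
  have hv0 : ∀ i, 0 ≤ v i := fun i => integral_nonneg fun ω => sq_nonneg _
  have hm0 : ∀ i, 0 ≤ ∫ ω, |X i ω| ^ p ∂P := fun i => integral_nonneg fun ω => by positivity
  -- As the variances add up to 1, the Gaussian splits into one factor per summand, and the two
  -- products are compared factor by factor.
  have hr : ((Real.exp (-(t ^ 2 / 2)) : ℝ) : ℂ)
      = ∏ i ∈ Finset.range N, ((Real.exp (-(t ^ 2 * v i / 2)) : ℝ) : ℂ) := by
    rw [← Complex.ofReal_prod, ← Real.exp_sum]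
    congr 2
    rw [Finset.sum_neg_distrib, ← Finset.sum_div, ← Finset.mul_sum, h1]
    ring
  rw [(hind.restrict _).charFun_map_fun_finsetSum_eq_prod fun i _ => (hX i).1.aemeasurable,
    Finset.prod_apply, hr]
  have hprob : ∀ i, IsProbabilityMeasure (P.map (X i)) := fun i =>
    Measure.isProbabilityMeasure_map (hX i).1.aemeasurable
  refine (norm_prod_sub_prod_le_sum _ _ _ (fun i _ => norm_charFun_le_one t) fun i _ => ?_).trans ?_
  · rw [Complex.norm_real, Real.norm_eq_abs, abs_of_pos (Real.exp_pos _)]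
    exact Real.exp_le_one_iff.2 (by have := hv0 i; nlinarith [sq_nonneg t, mul_nonneg (sq_nonneg t) this])
  have hterm : ∀ i ∈ Finset.range N,
      ‖charFun (P.map (X i)) t - ((Real.exp (-(t ^ 2 * v i / 2)) : ℝ) : ℂ)‖
      ≤ (3 * ε * t ^ 2 + t ^ 4 * (ε ^ 2 + ε ^ (2 - p) * S)) * v i
        + 3 * ε ^ (2 - p) * |t| ^ p * ∫ ω, |X i ω| ^ p ∂P := by
    intro i hi
    have a1 := norm_charFun_sub_taylor_two_le hp hε (hX i) (h0 i) t
    have a2 := abs_exp_neg_sub_one_sub_le (u := t ^ 2 * v i / 2) (by have := hv0 i; positivity)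
    have a3 : v i ≤ ε ^ 2 + ε ^ (2 - p) * S := by
      refine (integral_sq_le_rpow hp hε (hX i)).trans ?_
      gcongr
      exact Finset.single_le_sum (f := fun i => ∫ ω, |X i ω| ^ p ∂P) (fun i _ => hm0 i) hi
    have a4 : ‖(((1 - t ^ 2 * v i / 2 : ℝ) : ℂ)) - ((Real.exp (-(t ^ 2 * v i / 2)) : ℝ) : ℂ)‖
        ≤ (t ^ 2 * v i / 2) ^ 2 := by
      rw [← Complex.ofReal_sub, Complex.norm_real, Real.norm_eq_abs, abs_sub_comm]
      exact a2
    -- Only one factor of `v i ^ 2` is replaced by the uniform bound; the other is kept, to be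
    -- summed to 1.
    have a5 : (t ^ 2 * v i / 2) ^ 2 ≤ t ^ 4 * (ε ^ 2 + ε ^ (2 - p) * S) * v i := by
      have : t ^ 4 * (v i * v i) ≤ t ^ 4 * ((ε ^ 2 + ε ^ (2 - p) * S) * v i) := by
        have := hv0 i
        gcongr
      nlinarith [mul_nonneg (pow_nonneg (sq_nonneg t) 2) (mul_self_nonneg (v i))]
    refine (norm_sub_le_norm_sub_add_norm_sub _ (((1 - t ^ 2 * v i / 2 : ℝ) : ℂ)) _).trans ?_
    change ‖charFun (P.map (X i)) t - (((1 - t ^ 2 * v i / 2 : ℝ) : ℂ))‖ ≤ _ at a1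
    linarith
  refine (Finset.sum_le_sum hterm).trans (le_of_eq ?_)
  rw [Finset.sum_add_distrib, ← Finset.mul_sum, ← Finset.mul_sum, h1, ← hS]
  ring

/-- **Lyapunov's central limit theorem** for triangular arrays. -/
theorem tendstoInDistribution_sum_of_lyapunov {p : ℝ} (hp : 2 < p) {X : ℕ → ℕ → Ω → ℝ} {N : ℕ → ℕ}
    (hX : ∀ k i, MemLp (X k i) (ENNReal.ofReal p) P) (hind : ∀ k, iIndepFun (X k) P)
    (h0 : ∀ k i, ∫ ω, X k i ω ∂P = 0)
    (h1 : ∀ k, ∑ i ∈ Finset.range (N k), ∫ ω, X k i ω ^ 2 ∂P = 1)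
    (hlim : Tendsto (fun k => ∑ i ∈ Finset.range (N k), ∫ ω, |X k i ω| ^ p ∂P) atTop (𝓝 0)) :
    TendstoInDistribution (fun k ω => ∑ i ∈ Finset.range (N k), X k i ω) atTop (id : ℝ → ℝ)
      (fun _ => P) (gaussianReal 0 1) where
  forall_aemeasurable k := Finset.aemeasurable_fun_sum _ fun i _ => (hX k i).1.aemeasurable
  tendsto := by
    refine ProbabilityMeasure.tendsto_iff_tendsto_charFun.2 fun t => ?_
    have hg : charFun (Measure.map (id : ℝ → ℝ) (gaussianReal 0 1)) t
        = ((Real.exp (-(t ^ 2 / 2)) : ℝ) : ℂ) := by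
      rw [Measure.map_id, charFun_gaussianReal]
      push_cast
      congr 1
      simp
    change Tendsto (fun k => charFun (P.map fun ω => ∑ i ∈ Finset.range (N k), X k i ω) t) atTop
      (𝓝 (charFun (Measure.map (id : ℝ → ℝ) (gaussianReal 0 1)) t))
    rw [hg, tendsto_iff_norm_sub_tendsto_zero]
    have hsmall : Tendsto (fun ε : ℝ => 3 * ε * t ^ 2 + t ^ 4 * ε ^ 2) (𝓝[>] 0) (𝓝 0) := by
      have : Continuous fun ε : ℝ => 3 * ε * t ^ 2 + t ^ 4 * ε ^ 2 := by fun_prop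
      simpa using (this.tendsto 0).mono_left nhdsWithin_le_nhds
    rw [Metric.tendsto_atTop]
    intro δ hδ
    -- The cut `ε` is fixed before `k → ∞`, so that the coefficient containing `ε ^ (2 - p)` is a
    -- constant.
    obtain ⟨ε, hεδ, hε⟩ := ((hsmall.eventually_lt_const (half_pos hδ)).and
      self_mem_nhdsWithin).exists
    have hε : 0 < ε := hε
    have h2 := (hlim.const_mul (3 * ε ^ (2 - p) * |t| ^ p + t ^ 4 * ε ^ (2 - p)))
    rw [mul_zero] at h2
    obtain ⟨k0, hk0⟩ := eventually_atTop.1 (h2.eventually_lt_const (half_pos hδ))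
    refine ⟨k0, fun k hk => ?_⟩
    rw [Real.dist_eq, sub_zero, abs_of_nonneg (norm_nonneg _)]
    have := norm_charFun_sum_sub_gaussian_le hp hε (hX k) (hind k) (h0 k) (N k) (h1 k) t
    linarith [hk0 k hk]

end CLT

/-! ### Transfer of the Gaussian limit to nearby variables and to their variances. -/

section Transfer

variable {Ω : Type*} [MeasurableSpace Ω] {P : Measure Ω} [IsProbabilityMeasure P]

/-- Unlike the square itself, the truncated square is a bounded continuous test function. -/
theorem MeasureTheory.TendstoInDistribution.tendsto_integral_min_sq {l : ℕ → Ω → ℝ}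
    {ν : Measure ℝ} [IsProbabilityMeasure ν]
    (h : TendstoInDistribution l atTop (id : ℝ → ℝ) (fun _ => P) ν) {M : ℝ} (hM : 0 ≤ M) :
    Tendsto (fun k => ∫ ω, min (l k ω ^ 2) M ∂P) atTop (𝓝 (∫ x, min (x ^ 2) M ∂ν)) := by
  let g : BoundedContinuousFunction ℝ ℝ := BoundedContinuousFunction.ofNormedAddCommGroup
    (fun x : ℝ => min (x ^ 2) M) (by fun_prop) M (fun x => by
      rw [Real.norm_eq_abs, abs_of_nonneg (le_min (sq_nonneg x) hM)]
      exact min_le_right _ _)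
  have h1 := (ProbabilityMeasure.tendsto_iff_forall_integral_tendsto.1 h.tendsto) g
  simp only [ProbabilityMeasure.coe_mk, Measure.map_id] at h1
  refine h1.congr fun k => ?_
  rw [integral_map (h.forall_aemeasurable k) (by fun_prop)]
  rfl

theorem tendsto_integral_min_sq_gaussianReal :
    Tendsto (fun M : ℕ => ∫ x, min (x ^ 2) (M : ℝ) ∂(gaussianReal 0 1)) atTop (𝓝 1) := by
  have hL : MemLp (id : ℝ → ℝ) 2 (gaussianReal 0 1) := memLp_id_gaussianReal 2
  have hint : Integrable (fun x : ℝ => x ^ 2) (gaussianReal 0 1) := hL.integrable_sq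
  have h1 : ∫ x, x ^ 2 ∂(gaussianReal 0 1) = 1 := by
    have h := variance_id_gaussianReal (μ := 0) (v := 1)
    rw [variance_eq_sub hL] at h
    simpa using h
  rw [← h1]
  refine tendsto_integral_of_dominated_convergence (fun x => x ^ 2) (fun M => by fun_prop) hint
    (fun M => ae_of_all _ fun x => ?_) (ae_of_all _ fun x => ?_)
  · rw [Real.norm_eq_abs, abs_of_nonneg (le_min (sq_nonneg x) (Nat.cast_nonneg _))]
    exact min_le_left _ _
  · refine tendsto_const_nhds.congr' ?_
    filter_upwards [tendsto_natCast_atTop_atTop.eventually_ge_atTop (x ^ 2)] with M hM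
    rw [min_eq_left hM]

theorem tendsto_measureReal_compl {B : ℕ → Set Ω} (hB : ∀ k, MeasurableSet (B k))
    (hPB : Tendsto (fun k => P (B k)) atTop (𝓝 1)) :
    Tendsto (fun k => P.real (B k)ᶜ) atTop (𝓝 0) := by
  have h : Tendsto (fun k => P.real (B k)) atTop (𝓝 1) :=
    (ENNReal.tendsto_toReal ENNReal.one_ne_top).comp hPB
  have h2 := h.const_sub 1
  rw [sub_self] at h2
  refine h2.congr fun k => ?_
  rw [probReal_compl_eq_one_sub (hB k)]

/-- Squares of normalized variables converging to a standard Gaussian are uniformly integrable. -/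
theorem tendsto_setIntegral_compl_sq {l : ℕ → Ω → ℝ} (hl2 : ∀ k, MemLp (l k) 2 P)
    (hl1 : ∀ k, ∫ ω, l k ω ^ 2 ∂P = 1)
    (hl : TendstoInDistribution l atTop (id : ℝ → ℝ) (fun _ => P) (gaussianReal 0 1))
    {B : ℕ → Set Ω} (hB : ∀ k, MeasurableSet (B k))
    (hPB : Tendsto (fun k => P (B k)) atTop (𝓝 1)) :
    Tendsto (fun k => ∫ ω in (B k)ᶜ, l k ω ^ 2 ∂P) atTop (𝓝 0) := by
  -- The square is split at level `M`: the truncated part costs at most `M` times the measure of the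
  -- complement, the excess at most its integral over the whole space.
  have hle : ∀ (M : ℕ) k, ∫ ω in (B k)ᶜ, l k ω ^ 2 ∂P
      ≤ M * P.real (B k)ᶜ + (1 - ∫ ω, min (l k ω ^ 2) M ∂P) := by
    intro M k
    have hi := (hl2 k).integrable_sq
    have him : Integrable (fun ω => min (l k ω ^ 2) (M : ℝ)) P := hi.inf (integrable_const _)
    have hid : Integrable (fun ω => l k ω ^ 2 - min (l k ω ^ 2) (M : ℝ)) P := hi.sub him
    have e1 : ∫ ω in (B k)ᶜ, l k ω ^ 2 ∂P = ∫ ω in (B k)ᶜ, min (l k ω ^ 2) (M : ℝ) ∂P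
        + ∫ ω in (B k)ᶜ, (l k ω ^ 2 - min (l k ω ^ 2) (M : ℝ)) ∂P := by
      rw [← integral_add him.integrableOn hid.integrableOn]
      simp
    have e2 : ∫ ω in (B k)ᶜ, min (l k ω ^ 2) (M : ℝ) ∂P ≤ M * P.real (B k)ᶜ := by
      refine (setIntegral_mono him.integrableOn integrableOn_const
        (g := fun _ => (M : ℝ)) fun ω => min_le_right _ _).trans (le_of_eq ?_)
      simp [mul_comm]
    have e3 : ∫ ω in (B k)ᶜ, (l k ω ^ 2 - min (l k ω ^ 2) (M : ℝ)) ∂P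
        ≤ ∫ ω, (l k ω ^ 2 - min (l k ω ^ 2) (M : ℝ)) ∂P :=
      setIntegral_le_integral hid
        (ae_of_all _ fun ω => sub_nonneg.2 (min_le_left _ _))
    rw [integral_sub hi him, hl1 k] at e3
    linarith
  have h0 : ∀ k, 0 ≤ ∫ ω in (B k)ᶜ, l k ω ^ 2 ∂P := fun k =>
    integral_nonneg fun ω => sq_nonneg _
  rw [Metric.tendsto_atTop]
  intro δ hδ
  -- The level is chosen from the Gaussian limit alone, hence uniformly in `k`.
  obtain ⟨M, hM⟩ := (tendsto_integral_min_sq_gaussianReal.eventually_const_lt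
    (show 1 - δ < 1 by linarith)).exists
  have h2 := ((tendsto_measureReal_compl hB hPB).const_mul (M : ℝ)).add
    ((hl.tendsto_integral_min_sq (Nat.cast_nonneg M)).const_sub 1)
  rw [mul_zero, zero_add] at h2
  obtain ⟨k0, hk0⟩ := eventually_atTop.1 (h2.eventually_lt_const (show _ < δ by linarith))
  refine ⟨k0, fun k hk => ?_⟩
  rw [Real.dist_eq, sub_zero, abs_of_nonneg (h0 k)]
  exact (hle M k).trans_lt (hk0 k hk)

variable {l U : ℕ → Ω → ℝ} {B : ℕ → Set Ω} {ε : ℕ → ℝ}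

theorem tendstoInDistribution_of_abs_sub_le {ν : Measure ℝ} [IsProbabilityMeasure ν]
    (hl : TendstoInDistribution l atTop (id : ℝ → ℝ) (fun _ => P) ν)
    (hU : ∀ k, AEMeasurable (U k) P) (hB : ∀ k, MeasurableSet (B k))
    (hPB : Tendsto (fun k => P (B k)) atTop (𝓝 1)) (hε : Tendsto ε atTop (𝓝 0))
    (hUl : ∀ᶠ k in atTop, ∀ᵐ ω ∂P, ω ∈ B k → |U k ω - l k ω| ≤ ε k) :
    TendstoInDistribution U atTop (id : ℝ → ℝ) (fun _ => P) ν := by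
  refine tendstoInDistribution_of_tendstoInMeasure_sub U id hl ?_ hU
  rw [tendstoInMeasure_iff_measureReal_norm]
  intro δ hδ
  refine tendsto_of_tendsto_of_tendsto_of_le_of_le' tendsto_const_nhds
    (tendsto_measureReal_compl hB hPB) (Eventually.of_forall fun k => measureReal_nonneg) ?_
  filter_upwards [hUl, hε.eventually_lt_const hδ] with k hk hεk
  refine ENNReal.toReal_mono (measure_ne_top _ _) (measure_mono_ae ?_)
  filter_upwards [hk] with ω hω hmem
  by_contra hcon
  have hmB : ω ∈ B k := not_not.1 hcon
  have h1 : δ ≤ |U k ω - l k ω| := by simpa using! hmem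
  linarith [hω hmB]

/-- The difference `D` between the restricted variable and `l k` is at most `ε k` on `B k` and
equals `-l k` off it, so it tends to 0 in `L²`; its covariance with `l k` follows by Cauchy–Schwarz.
-/
theorem tendsto_variance_indicator (hl2 : ∀ k, MemLp (l k) 2 P)
    (hl0 : ∀ k, ∫ ω, l k ω ∂P = 0) (hl1 : ∀ k, ∫ ω, l k ω ^ 2 ∂P = 1)
    (hl : TendstoInDistribution l atTop (id : ℝ → ℝ) (fun _ => P) (gaussianReal 0 1))
    (hU : ∀ k, AEMeasurable (U k) P) (hB : ∀ k, MeasurableSet (B k))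
    (hPB : Tendsto (fun k => P (B k)) atTop (𝓝 1)) (hε : Tendsto ε atTop (𝓝 0))
    (hUl : ∀ᶠ k in atTop, ∀ᵐ ω ∂P, ω ∈ B k → |U k ω - l k ω| ≤ ε k) :
    Tendsto (fun k => variance ((B k).indicator (U k)) P) atTop (𝓝 1) := by
  have hlim : Tendsto (fun k => ε k ^ 2 + ∫ ω in (B k)ᶜ, l k ω ^ 2 ∂P) atTop (𝓝 0) := by
    simpa using (hε.pow 2).add (tendsto_setIntegral_compl_sq hl2 hl1 hl hB hPB)
  have hbound : ∀ᶠ k in atTop, |variance ((B k).indicator (U k)) P - 1|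
      ≤ 2 * √(ε k ^ 2 + ∫ ω in (B k)ᶜ, l k ω ^ 2 ∂P)
        + (ε k ^ 2 + ∫ ω in (B k)ᶜ, l k ω ^ 2 ∂P) := by
    filter_upwards [hUl] with k hk
    set η := ε k ^ 2 + ∫ ω in (B k)ᶜ, l k ω ^ 2 ∂P with hη
    set D : Ω → ℝ := (B k).indicator (U k) - l k with hD
    have hi := (hl2 k).integrable_sq
    have hDle : ∀ᵐ ω ∂P, D ω ^ 2 ≤ ε k ^ 2 + (B k)ᶜ.indicator (fun ω => l k ω ^ 2) ω := by
      filter_upwards [hk] with ω hω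
      by_cases hmem : ω ∈ B k
      · have := hω hmem
        simp only [hD, Pi.sub_apply, Set.indicator_of_mem hmem, Set.mem_compl_iff, hmem,
          not_true_eq_false, not_false_eq_true, Set.indicator_of_notMem, add_zero]
        rw [← sq_abs]
        gcongr
      · simp only [hD, Pi.sub_apply, Set.indicator_of_notMem hmem, Set.mem_compl_iff, hmem,
          not_false_eq_true, Set.indicator_of_mem]
        nlinarith [sq_nonneg (ε k)]
    have hbi : Integrable (fun ω => ε k ^ 2 + (B k)ᶜ.indicator (fun ω => l k ω ^ 2) ω) P :=
      (integrable_const _).add (hi.indicator (hB k).compl)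
    have hDm : AEStronglyMeasurable D P :=
      ((hU k).aestronglyMeasurable.indicator (hB k)).sub (hl2 k).1
    have hD2 : MemLp D 2 P := by
      rw [memLp_two_iff_integrable_sq hDm]
      refine hbi.mono' (hDm.pow 2) ?_
      filter_upwards [hDle] with ω hω
      rwa [Real.norm_eq_abs, abs_of_nonneg (sq_nonneg _)]
    have hDint : ∫ ω, D ω ^ 2 ∂P ≤ η := by
      refine (integral_mono_ae hD2.integrable_sq hbi hDle).trans (le_of_eq ?_)
      rw [integral_add (integrable_const _) (hi.indicator (hB k).compl),
        integral_indicator (hB k).compl]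
      simp [hη]
    have hη0 : 0 ≤ η := (integral_nonneg fun ω => sq_nonneg _).trans hDint
    have hvD : variance D P ≤ η := (variance_le_expectation_sq hDm).trans hDint
    have hvl : variance (l k) P = 1 := by
      rw [variance_eq_sub (hl2 k)]
      simp [hl0 k, hl1 k]
    have hcov : |covariance (l k) D P| ≤ √η := by
      refine Real.abs_le_sqrt ?_
      have hcs : covariance (l k) D P ^ 2 ≤ variance (l k) P * variance D P := by
        -- This quadratic in `t` is the variance of `t * l k + D`; its discriminant gives
        -- Cauchy–Schwarz.
        have hq : ∀ t : ℝ, 0 ≤ variance (l k) P * (t * t) + (2 * covariance (l k) D P) * t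
            + variance D P := by
          intro t
          have h := variance_nonneg (fun ω => t * l k ω + D ω) P
          rw [variance_fun_add ((hl2 k).const_mul t) hD2, variance_const_mul,
            covariance_const_mul_left] at h
          linarith
        have := discrim_le_zero hq
        rw [discrim] at this
        nlinarith
      rw [hvl, one_mul] at hcs
      linarith
    have hsplit : (B k).indicator (U k) = l k + D := by
      rw [hD]; abel
    rw [hsplit, variance_add (hl2 k) hD2, hvl]
    have h0 := variance_nonneg D P
    have := abs_le.1 hcov
    rw [abs_le]
    constructor <;> linarith
  rw [tendsto_iff_norm_sub_tendsto_zero]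
  refine squeeze_zero' (Eventually.of_forall fun k => norm_nonneg _) hbound ?_
  have := (((Real.continuous_sqrt.tendsto 0).comp hlim).const_mul 2).add hlim
  simpa using this

/-- Slutsky's theorem: the standard deviations are deterministic and tend to 1. -/
theorem tendstoInDistribution_indicator_div_sqrt_variance (hl2 : ∀ k, MemLp (l k) 2 P)
    (hl0 : ∀ k, ∫ ω, l k ω ∂P = 0) (hl1 : ∀ k, ∫ ω, l k ω ^ 2 ∂P = 1)
    (hl : TendstoInDistribution l atTop (id : ℝ → ℝ) (fun _ => P) (gaussianReal 0 1))
    (hU : ∀ k, AEMeasurable (U k) P) (hB : ∀ k, MeasurableSet (B k))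
    (hPB : Tendsto (fun k => P (B k)) atTop (𝓝 1)) (hε : Tendsto ε atTop (𝓝 0))
    (hUl : ∀ᶠ k in atTop, ∀ᵐ ω ∂P, ω ∈ B k → |U k ω - l k ω| ≤ ε k) :
    TendstoInDistribution
      (fun k ω => (B k).indicator (U k) ω / √(variance ((B k).indicator (U k)) P)) atTop
      (id : ℝ → ℝ) (fun _ => P) (gaussianReal 0 1) := by
  have hvar := tendsto_variance_indicator hl2 hl0 hl1 hl hU hB hPB hε hUl
  have hUi : ∀ k, AEMeasurable ((B k).indicator (U k)) P := fun k => (hU k).indicator (hB k)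
  have h1 : TendstoInDistribution (fun k => (B k).indicator (U k)) atTop (id : ℝ → ℝ)
      (fun _ => P) (gaussianReal 0 1) := by
    refine tendstoInDistribution_of_abs_sub_le hl hUi hB hPB hε ?_
    filter_upwards [hUl] with k hk
    filter_upwards [hk] with ω hω hmem
    rw [Set.indicator_of_mem hmem]
    exact hω hmem
  have h2 : Tendsto (fun k => (√(variance ((B k).indicator (U k)) P))⁻¹) atTop (𝓝 1) := by
    have := ((Real.continuous_sqrt.tendsto 1).comp hvar).inv₀ (by simp)
    simpa using this
  have h3 : TendstoInMeasure P
      (fun k (_ : Ω) => (√(variance ((B k).indicator (U k)) P))⁻¹) atTop (fun _ => (1 : ℝ)) :=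
    tendstoInMeasure_of_tendsto_ae (fun k => aestronglyMeasurable_const)
      (ae_of_all _ fun _ => h2)
  have h4 := h1.continuous_comp_prodMk_of_tendstoInMeasure_const
    (g := fun z : ℝ × ℝ => z.1 * z.2) (by fun_prop) h3 (fun k => aemeasurable_const)
  simp only [id, mul_one] at h4
  simpa only [div_eq_mul_inv] using! h4

end Transfer

/-- Division by the own standard deviation is invariant under scaling, so the deviation may first be
normalized by the linear noise. -/
theorem indicator_div_sqrt_variance_div {Ω : Type*} [MeasurableSpace Ω] (P : Measure Ω)
    (W : Ω → ℝ) (A : Set Ω) {s : ℝ} (hs : 0 < s) (ω : Ω) :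
    A.indicator (fun ω => W ω / s) ω / √(variance (A.indicator fun ω => W ω / s) P)
      = A.indicator W ω / √(variance (A.indicator W) P) := by
  have e : (A.indicator fun ω => W ω / s) = fun ω => s⁻¹ * A.indicator W ω := by
    ext ω
    by_cases h : ω ∈ A <;> simp [h, div_eq_inv_mul]
  rw [e, variance_const_mul, Real.sqrt_mul (sq_nonneg _), Real.sqrt_sq (by positivity)]
  exact mul_div_mul_left _ _ (by positivity)

/-! ### Taylor estimate and linearization along an orbit. -/

/-- The mean value inequality is applied to `f'`, then to `f t - f' y * t` on the segment; this
gives `H` in place of the sharp `H / 2`. -/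
theorem abs_sub_sub_deriv_mul_le {f : ℝ → ℝ} {s : Set ℝ} (hs : Convex ℝ s) {H : ℝ}
    (hf : ∀ t ∈ s, DifferentiableAt ℝ f t) (hf' : ∀ t ∈ s, DifferentiableAt ℝ (deriv f) t)
    (hH : ∀ t ∈ s, |deriv (deriv f) t| ≤ H) {y u : ℝ} (hy : y ∈ s) (hu : u ∈ s) :
    |f u - f y - deriv f y * (u - y)| ≤ H * (u - y) ^ 2 := by
  have hH0 : 0 ≤ H := (abs_nonneg _).trans (hH y hy)
  have hseg : segment ℝ y u ⊆ s := hs.segment_subset hy hu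
  have h := Convex.norm_image_sub_le_of_norm_deriv_le (𝕜 := ℝ)
    (f := fun t => f t - deriv f y * t) (C := H * |u - y|) (s := segment ℝ y u) (x := y) (y := u)
    (fun t ht => (hf t (hseg ht)).sub (by fun_prop)) (fun t ht => ?_) (convex_segment y u)
    (left_mem_segment ℝ y u) (right_mem_segment ℝ y u)
  · have e : f u - deriv f y * u - (f y - deriv f y * y) = f u - f y - deriv f y * (u - y) := by
      ring
    rw [e, Real.norm_eq_abs, Real.norm_eq_abs, mul_assoc, abs_mul_abs_self] at h
    rwa [sq]
  · have hd : deriv (fun t => f t - deriv f y * t) t = deriv f t - deriv f y := by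
      have h1 : HasDerivAt (fun t : ℝ => deriv f y * t) (deriv f y) t := by
        simpa using (hasDerivAt_id t).const_mul (deriv f y)
      exact ((hf t (hseg ht)).hasDerivAt.sub h1).deriv
    rw [hd]
    refine (hs.norm_image_sub_le_of_norm_deriv_le (𝕜 := ℝ) hf' hH hy (hseg ht)).trans ?_
    have : |t - y| ≤ |u - y| := by
      rw [segment_eq_uIcc] at ht
      exact Set.abs_sub_left_of_mem_uIcc ht
    rw [Real.norm_eq_abs]
    gcongr

section Cocycle

variable {g : ℝ → ℝ} {x : ℝ}

theorem differentiableAt_iterate_orbit (hd : ∀ m, DifferentiableAt ℝ g (g^[m] x)) (i j : ℕ) :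
    DifferentiableAt ℝ g^[i] (g^[j] x) := by
  induction i with
  | zero => exact differentiableAt_id
  | succ i ih =>
    rw [Function.iterate_succ']
    refine DifferentiableAt.comp _ ?_ ih
    rw [← Function.iterate_add_apply]
    exact hd _

theorem deriv_iterate_succ_orbit (hd : ∀ m, DifferentiableAt ℝ g (g^[m] x)) (i j : ℕ) :
    deriv g^[i + 1] (g^[j] x) = deriv g (g^[i + j] x) * deriv g^[i] (g^[j] x) := by
  rw [Function.iterate_succ', deriv_comp, ← Function.iterate_add_apply]
  · rw [← Function.iterate_add_apply]
    exact hd _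
  · exact differentiableAt_iterate_orbit hd i j

theorem deriv_iterate_zero (y : ℝ) : deriv g^[0] y = 1 := by
  simp

theorem sum_Icc_one_eq_sum_range {α : Type*} [AddCommMonoid α] (f : ℕ → α) (n : ℕ) :
    ∑ j ∈ Finset.Icc 1 n, f j = ∑ i ∈ Finset.range n, f (i + 1) := by
  rw [Finset.range_eq_Ico, Finset.sum_Ico_add' f 0 n 1]
  rfl

/-- Variation of constants along an orbit. -/
theorem eq_sum_deriv_iterate_mul (hd : ∀ m, DifferentiableAt ℝ g (g^[m] x)) {Δ r : ℕ → ℝ}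
    (h0 : Δ 0 = 0) {N : ℕ}
    (hs : ∀ m < N, Δ (m + 1) = deriv g (g^[m] x) * Δ m + r m) :
    ∀ m ≤ N, Δ m = ∑ i ∈ Finset.range m, deriv g^[m - (i + 1)] (g^[i + 1] x) * r i := by
  intro m
  induction m with
  | zero => intro _; simp [h0]
  | succ m ih =>
    intro hm
    rw [hs m hm, ih (by omega), Finset.sum_range_succ, Nat.sub_self, deriv_iterate_zero, one_mul,
      Finset.mul_sum]
    congr 1
    refine Finset.sum_congr rfl fun i hi => ?_
    have hi' := Finset.mem_range.1 hi
    have e : m + 1 - (i + 1) = (m - (i + 1)) + 1 := by omega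
    rw [e, deriv_iterate_succ_orbit hd]
    have e2 : m - (i + 1) + (i + 1) = m := by omega
    rw [e2]
    ring

/-- The maximum over `i` in `lyapunovHat` is what controls the propagated forcing at every
intermediate time; the term `j = 0` is dropped, as noise enters only from time 1. -/
theorem sum_abs_deriv_iterate_le_lyapunovHat {m N : ℕ} (hm : m ≤ N) :
    ∑ i ∈ Finset.range m, |deriv g^[m - (i + 1)] (g^[i + 1] x)| ≤ lyapunovHat g x N := by
  refine le_trans ?_ (Finset.le_sup' (fun i => ∑ j ∈ Finset.range (i + 1),
    |deriv (g^[i - j]) (g^[j] x)|) (Finset.mem_range.2 (by omega : m < N + 1)))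
  rw [Finset.sum_range_succ' _ m]
  linarith [abs_nonneg (deriv g^[m - 0] (g^[0] x))]

theorem one_le_lyapunovHat (N : ℕ) : 1 ≤ lyapunovHat g x N := by
  refine le_trans ?_ (Finset.le_sup' (fun i => ∑ j ∈ Finset.range (i + 1),
    |deriv (g^[i - j]) (g^[j] x)|) (Finset.mem_range.2 (by omega : 0 < N + 1)))
  simp

/-- Deviation of the noisy orbit from its linearization. -/
theorem abs_noisyOrbit_sub_sub_le {σ H M : ℝ} {z : ℕ → ℝ} {N : ℕ}
    (hd : ∀ m, DifferentiableAt ℝ g (g^[m] x)) (hσ : 0 ≤ σ) (hH : 0 ≤ H) (hM : 0 ≤ M)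
    (hz : ∀ j, 1 ≤ j → j ≤ N → |z j| ≤ M)
    (hT : ∀ m < N, |g (noisyOrbit g σ z x m) - g (g^[m] x)
      - deriv g (g^[m] x) * (noisyOrbit g σ z x m - g^[m] x)|
      ≤ H * (noisyOrbit g σ z x m - g^[m] x) ^ 2)
    (hsmall : H * lyapunovHat g x N ^ 2 * (σ * M) ≤ 1 / 4) :
    |noisyOrbit g σ z x N - g^[N] x
      - σ * ∑ j ∈ Finset.Icc 1 N, deriv g^[N - j] (g^[j] x) * z j|
      ≤ 4 * H * lyapunovHat g x N ^ 3 * (σ * M) ^ 2 := by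
  set L := lyapunovHat g x N with hL
  have hL1 : 1 ≤ L := one_le_lyapunovHat N
  set Δ : ℕ → ℝ := fun m => noisyOrbit g σ z x m - g^[m] x with hΔ
  set R : ℕ → ℝ := fun m => g (noisyOrbit g σ z x m) - g (g^[m] x) - deriv g (g^[m] x) * Δ m
    with hR
  have hsM : 0 ≤ σ * M := mul_nonneg hσ hM
  have hrec : ∀ m < N, Δ (m + 1) = deriv g (g^[m] x) * Δ m + (σ * z (m + 1) + R m) := by
    intro m _
    simp only [hΔ, hR, noisyOrbit, Function.iterate_succ_apply']
    ring
  have hsol := eq_sum_deriv_iterate_mul hd (Δ := Δ) (by simp [hΔ, noisyOrbit]) hrec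
  have hsum : ∀ m ≤ N, ∀ (r : ℕ → ℝ) (C : ℝ), 0 ≤ C → (∀ i < m, |r i| ≤ C) →
      |∑ i ∈ Finset.range m, deriv g^[m - (i + 1)] (g^[i + 1] x) * r i| ≤ L * C := by
    intro m hm r C hC hr
    refine (Finset.abs_sum_le_sum_abs _ _).trans ?_
    refine le_trans ?_
      (mul_le_mul_of_nonneg_right (sum_abs_deriv_iterate_le_lyapunovHat hm) hC)
    rw [Finset.sum_mul]
    refine Finset.sum_le_sum fun i hi => ?_
    rw [abs_mul]
    exact mul_le_mul_of_nonneg_left (hr i (Finset.mem_range.1 hi)) (abs_nonneg _)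
  have hRle : ∀ i < N, |Δ i| ≤ 2 * L * (σ * M) → |R i| ≤ 4 * H * L ^ 2 * (σ * M) ^ 2 := by
    intro i hi hb
    refine (hT i hi).trans ?_
    have : Δ i ^ 2 ≤ (2 * L * (σ * M)) ^ 2 := by rw [← sq_abs]; gcongr
    calc H * Δ i ^ 2 ≤ H * (2 * L * (σ * M)) ^ 2 := by gcongr
      _ = _ := by ring
  -- Bootstrap: the bound at all earlier times makes the quadratic remainders no larger than the
  -- noise, which gives the bound at time `m`.
  have hbound : ∀ m ≤ N, |Δ m| ≤ 2 * L * (σ * M) := by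
    intro m
    induction m using Nat.strong_induction_on with
    | _ m ih =>
      intro hm
      rw [hsol m hm]
      refine (hsum m hm (fun i => σ * z (i + 1) + R i) (2 * (σ * M)) (by positivity)
        fun i hi => ?_).trans (by linarith)
      have h1 := hRle i (by omega) (ih i hi (by omega))
      have h2 : |σ * z (i + 1)| ≤ σ * M := by
        rw [abs_mul, abs_of_nonneg hσ]
        exact mul_le_mul_of_nonneg_left (hz _ (by omega) (by omega)) hσ
      -- The threshold `1 / 4` is exactly what this inequality needs.
      have h3 : 4 * H * L ^ 2 * (σ * M) ^ 2 ≤ σ * M := by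
        nlinarith [mul_le_mul_of_nonneg_right hsmall hsM]
      exact (abs_add_le _ _).trans (by linarith)
  have e : noisyOrbit g σ z x N - g^[N] x
      - σ * ∑ j ∈ Finset.Icc 1 N, deriv g^[N - j] (g^[j] x) * z j
      = ∑ i ∈ Finset.range N, deriv g^[N - (i + 1)] (g^[i + 1] x) * R i := by
    change Δ N - _ = _
    rw [hsol N le_rfl, sum_Icc_one_eq_sum_range, Finset.mul_sum, ← Finset.sum_sub_distrib]
    refine Finset.sum_congr rfl fun i _ => ?_
    ring
  rw [e]
  refine (hsum N le_rfl R (4 * H * L ^ 2 * (σ * M) ^ 2) (by positivity) fun i hi =>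
    hRle i hi (hbound i hi.le)).trans (le_of_eq (by ring))

end Cocycle

/-! ### Bounds on the Lyapunov sums. -/

section Sums

variable {g : ℝ → ℝ} {x : ℝ}

theorem one_le_lyapunovSum (s : ℝ) {N : ℕ} (hN : 0 < N) : 1 ≤ lyapunovSum g s x N := by
  have h := Finset.single_le_sum (f := fun j => |deriv (g^[N - j]) (g^[j] x)| ^ s)
    (fun i _ => by positivity) (Finset.mem_Icc.2 ⟨hN, le_rfl⟩ : N ∈ Finset.Icc 1 N)
  simpa [lyapunovSum] using h

/-- The `ℓ²` norm is at most the `ℓ¹` norm. It allows the exponent 3 condition to control `Λ̂² σ` as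
well. -/
theorem sqrt_lyapunovSum_two_le (N : ℕ) : √(lyapunovSum g 2 x N) ≤ lyapunovHat g x N := by
  have h1 := sum_abs_deriv_iterate_le_lyapunovHat (g := g) (x := x) (le_refl N)
  rw [Real.sqrt_le_left (zero_le_one.trans (one_le_lyapunovHat N))]
  refine le_trans ?_ (pow_le_pow_left₀ (Finset.sum_nonneg fun i _ => abs_nonneg _) h1 2)
  rw [lyapunovSum, sum_Icc_one_eq_sum_range]
  simp only [Real.rpow_two]
  exact Finset.sum_sq_le_sq_sum_of_nonneg fun i _ => abs_nonneg _

/-- A contracting affine orbit violates the Lyapunov condition. -/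
theorem not_tendsto_lyapunov_of_deriv_eq {s p : ℝ} (hs : |s| < 1)
    (hp : 0 < p) (hd : ∀ m, DifferentiableAt ℝ g (g^[m] x)) (hg : ∀ m, deriv g (g^[m] x) = s)
    {n : ℕ → ℕ} (hn : ∀ k, 0 < n k) :
    ¬ Tendsto (fun k => lyapunovSum g p x (n k) / lyapunovSum g 2 x (n k) ^ (p / 2))
      atTop (𝓝 0) := by
  intro hlim
  have hD : ∀ i j, deriv g^[i] (g^[j] x) = s ^ i := by
    intro i j
    induction i with
    | zero => simp
    | succ i ih => rw [deriv_iterate_succ_orbit hd, hg, ih, pow_succ']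
  -- A geometric series bounds the denominator while the numerator is at least 1, so the ratio stays
  -- away from 0.
  have h2 : ∀ N, lyapunovSum g 2 x N ≤ (1 - |s|)⁻¹ := by
    intro N
    rw [lyapunovSum, sum_Icc_one_eq_sum_range]
    calc ∑ i ∈ Finset.range N, |deriv g^[N - (i + 1)] (g^[i + 1] x)| ^ (2 : ℝ)
        ≤ ∑ i ∈ Finset.range N, |s| ^ (N - 1 - i) := by
          refine Finset.sum_le_sum fun i _ => ?_
          rw [hD, abs_pow, Real.rpow_two, show N - (i + 1) = N - 1 - i by omega]
          have := pow_le_one₀ (abs_nonneg s) hs.le (n := N - 1 - i)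
          have := pow_nonneg (abs_nonneg s) (N - 1 - i)
          nlinarith
      _ = ∑ i ∈ Finset.range N, |s| ^ i := Finset.sum_range_reflect (fun i => |s| ^ i) N
      _ ≤ (1 - |s|)⁻¹ := by
          rw [← tsum_geometric_of_lt_one (abs_nonneg s) hs]
          exact (summable_geometric_of_lt_one (abs_nonneg s) hs).sum_le_tsum _
            fun i _ => by positivity
  have hK : 0 < (1 - |s|)⁻¹ := inv_pos.2 (by linarith)
  have h3 : 1 / (1 - |s|)⁻¹ ^ (p / 2) ≤ (0 : ℝ) := by
    refine ge_of_tendsto hlim (Eventually.of_forall fun k => ?_)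
    have a1 := one_le_lyapunovSum (g := g) (x := x) p (hn k)
    have a2 := one_le_lyapunovSum (g := g) (x := x) 2 (hn k)
    have a3 : 0 < lyapunovSum g 2 x (n k) ^ (p / 2) := Real.rpow_pos_of_pos (by linarith) _
    exact div_le_div₀ (by linarith) a1 a3 (Real.rpow_le_rpow (by linarith) (h2 _) (by linarith))
  exact absurd h3 (not_le.2 (by positivity))

end Sums

theorem ContDiffAt.deriv_right_of_le {f : ℝ → ℝ} {t : ℝ} {m n : WithTop ℕ∞}
    (h : ContDiffAt ℝ n f t) (hmn : m + 1 ≤ n) : ContDiffAt ℝ m (deriv f) t := by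
  have h1 := (h.fderiv_right hmn).clm_apply (contDiffAt_const (c := (1 : ℝ)))
  simpa only [fderiv_apply_one_eq_deriv] using h1

/-! ### The three phase spaces and the control of the second derivative. -/

section Maps

namespace WeakNoiseMap

theorem abs_deriv_deriv_le (S : WeakNoiseMap) (hS : S.secondDerivSup ≠ ⊤) {y : ℝ}
    (hy : y ∈ S.space) : |deriv (deriv S.coord) y| ≤ S.secondDerivSup.toReal := by
  rw [← ENNReal.ofReal_le_iff_le_toReal hS]
  exact le_iSup₂_of_le y hy le_rfl

theorem contDiffAt_interval {f : ℝ → ℝ} {a : ℝ}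
    (smooth : ContDiffOn ℝ 2 f (Set.Icc (-1 - a) (1 + a))) {t : ℝ}
    (ht : t ∈ Set.Ioo (-1 - a) (1 + a)) : ContDiffAt ℝ 2 f t :=
  smooth.contDiffAt (Icc_mem_nhds ht.1 ht.2)

theorem contDiffAt_coord (S : WeakNoiseMap) {y : ℝ} (hy : y ∈ S.space) :
    ContDiffAt ℝ 2 S.coord y := by
  cases S with
  | line f smooth => exact smooth.contDiffAt
  | circle f F smooth lifts => exact smooth.contDiffAt
  | interval f a a_pos smooth maps =>
    exact contDiffAt_interval smooth ⟨by linarith [hy.1], by linarith [hy.2]⟩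

theorem iterate_mem_space (S : WeakNoiseMap) {x : ℝ} (hx : x ∈ S.space) (m : ℕ) :
    S.coord^[m] x ∈ S.space := by
  cases S with
  | line f smooth => trivial
  | circle f F smooth lifts => trivial
  | interval f a a_pos smooth maps =>
    refine Set.MapsTo.iterate (f := f) (s := Set.Icc (-1) 1) (fun t ht => ?_) m hx
    exact maps ⟨by linarith [ht.1], by linarith [ht.2]⟩

theorem differentiableAt_orbit (S : WeakNoiseMap) {x : ℝ} (hx : x ∈ S.space) (m : ℕ) :
    DifferentiableAt ℝ S.coord (S.coord^[m] x) :=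
  (S.contDiffAt_coord (S.iterate_mem_space hx m)).differentiableAt (by norm_num)

theorem differentiableAt_deriv_coord (S : WeakNoiseMap) {y : ℝ} (hy : y ∈ S.space) :
    DifferentiableAt ℝ (deriv S.coord) y :=
  ((S.contDiffAt_coord hy).deriv_right_of_le (m := 1) (by norm_num)).differentiableAt (by norm_num)

theorem convex_space (S : WeakNoiseMap) : Convex ℝ S.space := by
  cases S with
  | line f smooth => exact convex_univ
  | circle f F smooth lifts => exact convex_univ
  | interval f a a_pos smooth maps => exact convex_Icc _ _

/-- An interval map of the class considered cannot be affine with slope `±1`, and a contraction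
violates the Lyapunov condition; so its second derivative does not vanish identically. -/
theorem secondDerivSup_toReal_pos_of_interval {f : ℝ → ℝ} {a : ℝ} (a_pos : 0 < a)
    (smooth : ContDiffOn ℝ 2 f (Set.Icc (-1 - a) (1 + a)))
    (maps : Set.MapsTo f (Set.Icc (-1 - a) (1 + a)) (Set.Icc (-1) 1))
    (hS : (interval f a a_pos smooth maps).secondDerivSup ≠ ⊤)
    {x p : ℝ} (hx : x ∈ Set.Icc (-1 : ℝ) 1) (hp : 0 < p) {n : ℕ → ℕ} (hn : ∀ k, 0 < n k)
    (hlyap : Tendsto (fun k => lyapunovSum f p x (n k) / lyapunovSum f 2 x (n k) ^ (p / 2))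
      atTop (𝓝 0)) :
    0 < (interval f a a_pos smooth maps).secondDerivSup.toReal := by
  set S := interval f a a_pos smooth maps with hSdef
  refine lt_of_le_of_ne ENNReal.toReal_nonneg fun h0 => ?_
  have hderiv : ∀ y ∈ Set.Icc (-1 : ℝ) 1, deriv f y = deriv f 1 := by
    intro y hy
    have h := S.convex_space.norm_image_sub_le_of_norm_deriv_le (𝕜 := ℝ) (f := deriv f) (C := 0)
      (fun t ht => S.differentiableAt_deriv_coord ht)
      (fun t ht => (S.abs_deriv_deriv_le hS ht).trans h0.symm.le)
      (show (1 : ℝ) ∈ S.space from ⟨by norm_num, le_rfl⟩) (show y ∈ S.space from hy)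
    rw [zero_mul] at h
    exact sub_eq_zero.1 (norm_le_zero_iff.1 h)
  have hincr : f 1 - f (-1) = deriv f 1 * 2 := by
    have h := abs_sub_sub_deriv_mul_le S.convex_space (f := f) (H := 0) (y := 1) (u := -1)
      (fun t ht => (S.contDiffAt_coord ht).differentiableAt (by norm_num))
      (fun t ht => S.differentiableAt_deriv_coord ht)
      (fun t ht => (S.abs_deriv_deriv_le hS ht).trans h0.symm.le)
      ⟨by norm_num, le_rfl⟩ ⟨le_rfl, by norm_num⟩
    rw [zero_mul] at h
    linarith [abs_nonpos_iff.1 h]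
  have hf1 : f 1 ∈ Set.Icc (-1 : ℝ) 1 := maps ⟨by linarith, by linarith⟩
  have hf2 : f (-1) ∈ Set.Icc (-1 : ℝ) 1 := maps ⟨by linarith, by linarith⟩
  have hnhds : Set.Icc (-1 - a) (1 + a) ∈ 𝓝 (1 : ℝ) := Icc_mem_nhds (by linarith) (by linarith)
  -- Slope `±1` would force `f 1 = ±1`, an extreme value of `f` attained in the interior of `[-1-a,
  -- 1+a]`, where the derivative must vanish.
  have hs : |deriv f 1| < 1 := by
    refine lt_of_le_of_ne (abs_le.2 ⟨by linarith [hf1.1, hf2.2], by linarith [hf1.2, hf2.1]⟩)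
      fun habs => ?_
    rcases eq_or_eq_neg_of_abs_eq habs with h1 | h1
    · have hmax : IsLocalMax f 1 := by
        filter_upwards [hnhds] with t ht
        linarith [(maps ht).2, hf2.1]
      rw [hmax.deriv_eq_zero] at h1
      norm_num at h1
    · have hmin : IsLocalMin f 1 := by
        filter_upwards [hnhds] with t ht
        linarith [(maps ht).1, hf2.2]
      rw [hmin.deriv_eq_zero] at h1
      norm_num at h1
  exact not_tendsto_lyapunov_of_deriv_eq hs hp (S.differentiableAt_orbit hx)
    (fun m => hderiv _ (S.iterate_mem_space hx m)) hn hlyap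

theorem abs_le_noiseMax {Ω : Type*} (ξ : ℕ → Ω → ℝ) {j n : ℕ} (h1 : 1 ≤ j) (h2 : j ≤ n) (ω : Ω) :
    |ξ j ω| ≤ noiseMax ξ n ω := by
  have h := Finset.le_sup (f := fun j => ‖ξ j ω‖₊) (Finset.mem_Icc.2 ⟨h1, h2⟩)
  exact_mod_cast h

theorem noiseMax_nonneg {Ω : Type*} (ξ : ℕ → Ω → ℝ) (n : ℕ) (ω : Ω) : 0 ≤ noiseMax ξ n ω :=
  NNReal.coe_nonneg _

/-- On the line and the circle `H` is the supremum itself. On the interval it must bound `f''` on a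
neighbourhood of `I`, and `κ` converts it back to a multiple of the supremum over `I`. -/
theorem exists_taylor_bound {Ω : Type*} (S : WeakNoiseMap) (ξ : ℕ → Ω → ℝ)
    (hS : S.secondDerivSup ≠ ⊤) {x p : ℝ} (hx : x ∈ S.space) (hp : 0 < p) {n : ℕ → ℕ}
    (hn : ∀ k, 0 < n k)
    (hlyap : Tendsto (fun k => lyapunovSum S.coord p x (n k)
      / lyapunovSum S.coord 2 x (n k) ^ (p / 2)) atTop (𝓝 0)) :
    ∃ H b κ : ℝ, 0 ≤ H ∧ 0 < b ∧ H ≤ κ * S.secondDerivSup.toReal ∧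
      ∀ (σ : ℝ) (N : ℕ) (ω : Ω), 0 ≤ σ → H * (σ * noiseMax ξ N ω) ≤ b →
        ω ∈ S.admissible ξ σ N ∧ ∀ m < N, ∀ u y, u = noisyOrbit S.coord σ (fun j => ξ j ω) x m →
          y = S.coord^[m] x →
          |S.coord u - S.coord y - deriv S.coord y * (u - y)| ≤ H * (u - y) ^ 2 := by
  have hline : S.space = Set.univ → (∀ σ N, S.admissible ξ σ N = Set.univ) →
      ∃ H b κ : ℝ, 0 ≤ H ∧ 0 < b ∧ H ≤ κ * S.secondDerivSup.toReal ∧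
      ∀ (σ : ℝ) (N : ℕ) (ω : Ω), 0 ≤ σ → H * (σ * noiseMax ξ N ω) ≤ b →
        ω ∈ S.admissible ξ σ N ∧ ∀ m < N, ∀ u y, u = noisyOrbit S.coord σ (fun j => ξ j ω) x m →
          y = S.coord^[m] x →
          |S.coord u - S.coord y - deriv S.coord y * (u - y)| ≤ H * (u - y) ^ 2 := by
    intro huniv hadm
    refine ⟨S.secondDerivSup.toReal, 1, 1, ENNReal.toReal_nonneg, one_pos, by rw [one_mul],
      fun σ N ω _ _ => ⟨by rw [hadm]; trivial, fun m _ u y _ _ => ?_⟩⟩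
    have hmem : ∀ t, t ∈ S.space := fun t => by rw [huniv]; trivial
    exact abs_sub_sub_deriv_mul_le S.convex_space
      (fun t ht => (S.contDiffAt_coord ht).differentiableAt (by norm_num))
      (fun t ht => S.differentiableAt_deriv_coord ht) (fun t ht => S.abs_deriv_deriv_le hS ht)
      (hmem y) (hmem u)
  cases hSd : S with
  | line f smooth => subst hSd; exact hline rfl fun _ _ => rfl
  | circle f F smooth lifts => subst hSd; exact hline rfl fun _ _ => rfl
  | interval f a a_pos smooth maps =>
    subst hSd
    have hpos := secondDerivSup_toReal_pos_of_interval a_pos smooth maps hS hx hp hn hlyap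
    set h := (interval f a a_pos smooth maps).secondDerivSup.toReal
    -- Half of the margin `a` is given up so that this compact interval lies in the interior of the
    -- domain of smoothness.
    have hsub : ∀ t ∈ Set.Icc (-1 - a / 2) (1 + a / 2), ContDiffAt ℝ 2 f t := fun t ht =>
      contDiffAt_interval smooth ⟨by linarith [ht.1], by linarith [ht.2]⟩
    have hdd : ∀ t ∈ Set.Icc (-1 - a / 2) (1 + a / 2), ContDiffAt ℝ 1 (deriv f) t := fun t ht =>
      (hsub t ht).deriv_right_of_le (by norm_num)
    have hcont : ContinuousOn (deriv (deriv f)) (Set.Icc (-1 - a / 2) (1 + a / 2)) := fun t ht =>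
      ((hdd t ht).deriv_right_of_le (m := 0) (by norm_num)).continuousAt.continuousWithinAt
    obtain ⟨H0, hH0⟩ := isCompact_Icc.exists_bound_of_continuousOn hcont
    set H := max H0 h
    have hH : 0 < H := hpos.trans_le (le_max_right _ _)
    -- Dividing by `H > 0`, the threshold means `σ max |ξ_j| ≤ a / 2`, which keeps the noisy orbit
    -- in the smaller interval.
    refine ⟨H, H * (a / 2), H / h, hH.le, by positivity,
      by rw [div_mul_cancel₀ _ hpos.ne'], fun σ N ω hσ hle => ?_⟩
    have hσM : σ * noiseMax ξ N ω ≤ a / 2 := le_of_mul_le_mul_left hle hH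
    refine ⟨show σ * noiseMax ξ N ω ≤ a by linarith, fun m hm u y hu hy => ?_⟩
    have hum : u ∈ Set.Icc (-1 - a / 2) (1 + a / 2) := by
      have : ∀ m ≤ N, noisyOrbit f σ (fun j => ξ j ω) x m ∈ Set.Icc (-1 - a / 2) (1 + a / 2) := by
        intro m
        induction m with
        | zero =>
          intro _
          exact ⟨by linarith [hx.1, show noisyOrbit f σ (fun j => ξ j ω) x 0 = x from rfl],
            by linarith [hx.2, show noisyOrbit f σ (fun j => ξ j ω) x 0 = x from rfl]⟩
        | succ m ih =>
          intro hm
          have h1 := ih (by omega)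
          have h2 := maps (show noisyOrbit f σ (fun j => ξ j ω) x m ∈ Set.Icc (-1 - a) (1 + a) from
            ⟨by linarith [h1.1], by linarith [h1.2]⟩)
          have h3 : |σ * ξ (m + 1) ω| ≤ a / 2 := by
            rw [abs_mul, abs_of_nonneg hσ]
            exact (mul_le_mul_of_nonneg_left (abs_le_noiseMax ξ (by omega) hm ω) hσ).trans hσM
          have h4 := abs_le.1 h3
          simp only [noisyOrbit]
          exact ⟨by linarith [h2.1], by linarith [h2.2]⟩
      rw [hu]
      exact this m hm.le
    have hym : y ∈ Set.Icc (-1 - a / 2) (1 + a / 2) := by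
      have : y ∈ Set.Icc (-1 : ℝ) 1 := by
        rw [hy]
        exact (interval f a a_pos smooth maps).iterate_mem_space hx m
      exact ⟨by linarith [this.1], by linarith [this.2]⟩
    exact abs_sub_sub_deriv_mul_le (convex_Icc _ _)
      (fun t ht => (hsub t ht).differentiableAt (by norm_num))
      (fun t ht => (hdd t ht).differentiableAt (by norm_num))
      (fun t ht => (hH0 t ht).trans (le_max_left _ _)) hym hum

/-- On the event that the noise is small, the noisy orbit is admissible and close to its
linearization. -/
theorem exists_linearization_bound {Ω : Type*} (S : WeakNoiseMap) (ξ : ℕ → Ω → ℝ)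
    (hS : S.secondDerivSup ≠ ⊤) {x p : ℝ} (hx : x ∈ S.space) (hp : 0 < p) {n : ℕ → ℕ}
    (hn : ∀ k, 0 < n k)
    (hlyap : Tendsto (fun k => lyapunovSum S.coord p x (n k)
      / lyapunovSum S.coord 2 x (n k) ^ (p / 2)) atTop (𝓝 0)) :
    ∃ H b κ : ℝ, 0 ≤ H ∧ 0 < b ∧ H ≤ κ * S.secondDerivSup.toReal ∧
      ∀ (σ : ℝ) (N : ℕ) (ω : Ω), 0 ≤ σ →
        H * lyapunovHat S.coord x N ^ 2 * (σ * noiseMax ξ N ω) ≤ b →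
        ω ∈ S.admissible ξ σ N ∧
        |noisyOrbit S.coord σ (fun j => ξ j ω) x N - S.coord^[N] x
          - σ * linearNoise S.coord ξ x N ω|
          ≤ 4 * H * lyapunovHat S.coord x N ^ 3 * (σ * noiseMax ξ N ω) ^ 2 := by
  obtain ⟨H, b, κ, hH, hb, hκ, h⟩ := S.exists_taylor_bound ξ hS hx hp hn hlyap
  refine ⟨H, min b (1 / 4), κ, hH, by positivity, hκ, fun σ N ω hσ hle => ?_⟩
  have hsM : 0 ≤ σ * noiseMax ξ N ω := mul_nonneg hσ (noiseMax_nonneg ξ N ω)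
  have h1 : H * (σ * noiseMax ξ N ω) ≤ b := by
    refine le_trans ?_ (hle.trans (min_le_left _ _))
    refine mul_le_mul_of_nonneg_right ?_ hsM
    exact le_mul_of_one_le_right hH (one_le_pow₀ (one_le_lyapunovHat N))
  obtain ⟨h2, h3⟩ := h σ N ω hσ h1
  refine ⟨h2, ?_⟩
  exact abs_noisyOrbit_sub_sub_le (S.differentiableAt_orbit hx) hσ hH (noiseMax_nonneg ξ N ω)
    (fun j hj hjN => abs_le_noiseMax ξ hj hjN ω) (fun m hm => h3 m hm _ _ rfl rfl)
    (hle.trans (min_le_right _ _))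

end WeakNoiseMap

end Maps

/-! ### Moments of the noise and the limit law of the linearized noise. -/

section Moments

variable {Ω : Type*} [MeasurableSpace Ω] {P : Measure Ω}

theorem MeasureTheory.MemLp.integral_rpow_abs_le {X : Ω → ℝ} {p C : ℝ} (hp : 0 < p) (hC : 0 ≤ C)
    (hX : MemLp X (ENNReal.ofReal p) P)
    (h : eLpNorm X (ENNReal.ofReal p) P ≤ ENNReal.ofReal C) : ∫ ω, |X ω| ^ p ∂P ≤ C ^ p := by
  rw [hX.eLpNorm_eq_integral_rpow_norm (by simpa using hp) ENNReal.ofReal_ne_top,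
    ENNReal.toReal_ofReal hp.le, ENNReal.ofReal_le_ofReal_iff hC] at h
  exact (Real.rpow_inv_le_iff_of_pos (integral_nonneg fun ω => by positivity) hC hp).1 h

theorem MeasureTheory.MemLp.sq_le_integral_sq {X : Ω → ℝ} {c : ℝ} (hc : 0 ≤ c)
    (hX : MemLp X 2 P) (h : ENNReal.ofReal c ≤ eLpNorm X 2 P) : c ^ 2 ≤ ∫ ω, X ω ^ 2 ∂P := by
  have h0 : 0 ≤ ∫ ω, ‖X ω‖ ^ (2 : ℝ) ∂P := integral_nonneg fun ω => by positivity
  rw [hX.eLpNorm_eq_integral_rpow_norm (by norm_num) (by norm_num), ENNReal.toReal_ofNat,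
    ENNReal.ofReal_le_ofReal_iff (by positivity), Real.le_rpow_inv_iff_of_pos hc h0 two_pos] at h
  simpa [Real.rpow_two] using h

theorem measurable_noiseMax {ξ : ℕ → Ω → ℝ} (hmeas : ∀ j, 1 ≤ j → Measurable (ξ j)) (N : ℕ) :
    Measurable (noiseMax ξ N) := by
  have h : Measurable fun ω => (Finset.Icc 1 N).sup fun j => ‖ξ j ω‖₊ := by
    have h1 := Finset.sup_induction (s := Finset.Icc 1 N) (f := fun j ω => ‖ξ j ω‖₊)
      (p := Measurable) measurable_const (fun a ha b hb => ha.sup hb)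
      fun j hj => (hmeas j (Finset.mem_Icc.1 hj).1).nnnorm
    convert h1 using 1
    ext1 ω
    simp [Finset.sup_apply]
  exact measurable_coe_nnreal_real.comp h

theorem noiseMax_le_iff {Ω : Type*} {ξ : ℕ → Ω → ℝ} {N : ℕ} {ω : Ω} {R : ℝ} (hR : 0 ≤ R) :
    noiseMax ξ N ω ≤ R ↔ ∀ j, 1 ≤ j → j ≤ N → |ξ j ω| ≤ R := by
  refine ⟨fun h j h1 h2 => (WeakNoiseMap.abs_le_noiseMax ξ h1 h2 ω).trans h, fun h => ?_⟩
  lift R to NNReal using hR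
  refine NNReal.coe_le_coe.2 (Finset.sup_le fun j hj => ?_)
  have := h j (Finset.mem_Icc.1 hj).1 (Finset.mem_Icc.1 hj).2
  exact_mod_cast this

theorem memLp_noiseMax {ξ : ℕ → Ω → ℝ} (hmeas : ∀ j, 1 ≤ j → Measurable (ξ j)) {q : ENNReal}
    (hq : ∀ j, 1 ≤ j → MemLp (ξ j) q P) (N : ℕ) : MemLp (noiseMax ξ N) q P := by
  have h : MemLp (fun ω => ∑ j ∈ Finset.Icc 1 N, ‖ξ j ω‖) q P :=
    memLp_finsetSum _ fun j hj => (hq j (Finset.mem_Icc.1 hj).1).norm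
  refine h.mono (measurable_noiseMax hmeas N).aestronglyMeasurable (ae_of_all _ fun ω => ?_)
  have h0 : 0 ≤ ∑ j ∈ Finset.Icc 1 N, ‖ξ j ω‖ := Finset.sum_nonneg fun j _ => norm_nonneg _
  rw [Real.norm_eq_abs, Real.norm_eq_abs, abs_of_nonneg (WeakNoiseMap.noiseMax_nonneg ξ N ω),
    abs_of_nonneg h0, noiseMax_le_iff h0]
  intro j h1 h2
  exact Finset.single_le_sum (f := fun j => ‖ξ j ω‖) (fun _ _ => norm_nonneg _)
    (Finset.mem_Icc.2 ⟨h1, h2⟩)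

/-- Keeps the norm of the maximum bounded below uniformly in `N`. -/
theorem eLpNorm_one_le_noiseMax {ξ : ℕ → Ω → ℝ} {q : ENNReal} {N : ℕ} (hN : 0 < N) :
    eLpNorm (ξ 1) q P ≤ eLpNorm (noiseMax ξ N) q P := by
  refine eLpNorm_mono fun ω => ?_
  rw [Real.norm_eq_abs, Real.norm_eq_abs, abs_of_nonneg (WeakNoiseMap.noiseMax_nonneg ξ N ω)]
  exact WeakNoiseMap.abs_le_noiseMax ξ le_rfl hN ω

theorem linearNoise_eq_sum_range {Ω : Type*} (g : ℝ → ℝ) (ξ : ℕ → Ω → ℝ) (x : ℝ) (N : ℕ) (ω : Ω) :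
    linearNoise g ξ x N ω
      = ∑ i ∈ Finset.range N, deriv g^[N - (i + 1)] (g^[i + 1] x) * ξ (i + 1) ω :=
  sum_Icc_one_eq_sum_range _ _

variable {ξ : ℕ → Ω → ℝ} {g : ℝ → ℝ} {x : ℝ}

theorem memLp_linearNoise {q : ENNReal} (hq : ∀ j, 1 ≤ j → MemLp (ξ j) q P) (N : ℕ) :
    MemLp (linearNoise g ξ x N) q P :=
  memLp_finsetSum _ fun j hj => (hq j (Finset.mem_Icc.1 hj).1).const_mul _

theorem measure_lt_noiseMax_le
    (hmeas : ∀ j, 1 ≤ j → Measurable (ξ j)) {p : ℝ} (hp : 0 < p) {N : ℕ}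
    {m T : ℝ} (hm : 0 < m) (hT : 0 < T)
    (h : eLpNorm (noiseMax ξ N) (ENNReal.ofReal p) P = ENNReal.ofReal m) :
    P {ω | T * m < noiseMax ξ N ω} ≤ ENNReal.ofReal (T⁻¹) ^ p := by
  have h1 := meas_ge_le_mul_pow_eLpNorm_enorm (p := ENNReal.ofReal p) P (by simpa using hp)
    ENNReal.ofReal_ne_top (f := noiseMax ξ N) (measurable_noiseMax hmeas N).aestronglyMeasurable
    (ε := ENNReal.ofReal (T * m)) (by simpa using mul_pos hT hm) (by simp)
  refine (measure_mono fun ω hω => ?_).trans (h1.trans (le_of_eq ?_))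
  · have hω' : T * m < noiseMax ξ N ω := hω
    change ENNReal.ofReal (T * m) ≤ ‖noiseMax ξ N ω‖ₑ
    rw [Real.enorm_eq_ofReal (WeakNoiseMap.noiseMax_nonneg ξ N ω)]
    exact ENNReal.ofReal_le_ofReal hω'.le
  · rw [h, ENNReal.toReal_ofReal hp.le, ← ENNReal.mul_rpow_of_nonneg _ _ hp.le,
      ← ENNReal.ofReal_inv_of_pos (by positivity), ← ENNReal.ofReal_mul (by positivity)]
    congr 2
    field_simp

variable [IsProbabilityMeasure P]

theorem integral_linearNoise (hq : ∀ j, 1 ≤ j → MemLp (ξ j) 2 P)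
    (hmean : ∀ j, 1 ≤ j → ∫ ω, ξ j ω ∂P = 0) (N : ℕ) :
    ∫ ω, linearNoise g ξ x N ω ∂P = 0 := by
  unfold linearNoise
  rw [integral_finsetSum]
  · refine Finset.sum_eq_zero fun j hj => ?_
    rw [integral_const_mul, hmean j (Finset.mem_Icc.1 hj).1, mul_zero]
  · exact fun j hj => ((hq j (Finset.mem_Icc.1 hj).1).integrable (by norm_num)).const_mul _

theorem variance_linearNoise (hq : ∀ j, 1 ≤ j → MemLp (ξ j) 2 P)
    (hindep : iIndepFun (fun j : ℕ => ξ (j + 1)) P)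
    (hmean : ∀ j, 1 ≤ j → ∫ ω, ξ j ω ∂P = 0) (N : ℕ) :
    variance (linearNoise g ξ x N) P
      = ∑ i ∈ Finset.range N, deriv g^[N - (i + 1)] (g^[i + 1] x) ^ 2
        * ∫ ω, ξ (i + 1) ω ^ 2 ∂P := by
  have e : linearNoise g ξ x N = ∑ i ∈ Finset.range N,
      fun ω => deriv g^[N - (i + 1)] (g^[i + 1] x) * ξ (i + 1) ω := by
    ext ω
    rw [linearNoise_eq_sum_range, Finset.sum_apply]
  rw [e, IndepFun.variance_sum]
  · refine Finset.sum_congr rfl fun i _ => ?_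
    rw [variance_const_mul, variance_eq_sub (hq _ (by omega)), hmean _ (by omega)]
    simp
  · exact fun i _ => (hq _ (by omega)).const_mul _
  · intro i _ j _ hij
    exact (hindep.indepFun hij).comp (measurable_const_mul _) (measurable_const_mul _)

theorem sq_mul_lyapunovSum_le_variance {c : ℝ} (hc : 0 ≤ c) (hq : ∀ j, 1 ≤ j → MemLp (ξ j) 2 P)
    (hindep : iIndepFun (fun j : ℕ => ξ (j + 1)) P)
    (hmean : ∀ j, 1 ≤ j → ∫ ω, ξ j ω ∂P = 0)
    (hlow : ∀ j, 1 ≤ j → ENNReal.ofReal c ≤ eLpNorm (ξ j) 2 P) (N : ℕ) :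
    c ^ 2 * lyapunovSum g 2 x N ≤ variance (linearNoise g ξ x N) P := by
  rw [variance_linearNoise hq hindep hmean, lyapunovSum, sum_Icc_one_eq_sum_range, Finset.mul_sum]
  refine Finset.sum_le_sum fun i _ => ?_
  rw [Real.rpow_two, sq_abs, mul_comm]
  exact mul_le_mul_of_nonneg_left ((hq _ (by omega)).sq_le_integral_sq hc (hlow _ (by omega)))
    (sq_nonneg _)

/-- The moment bounds give a Lyapunov ratio of at most `(C / c)^p` times the ratio of the
deterministic sums. -/
theorem tendstoInDistribution_linearNoise {p c C : ℝ} (hp : 2 < p) (hc : 0 < c) (hC : 0 ≤ C)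
    (hq : ∀ j, 1 ≤ j → MemLp (ξ j) (ENNReal.ofReal p) P)
    (hindep : iIndepFun (fun j : ℕ => ξ (j + 1)) P)
    (hmean : ∀ j, 1 ≤ j → ∫ ω, ξ j ω ∂P = 0)
    (hlow : ∀ j, 1 ≤ j → ENNReal.ofReal c ≤ eLpNorm (ξ j) 2 P)
    (hup : ∀ j, 1 ≤ j → eLpNorm (ξ j) (ENNReal.ofReal p) P ≤ ENNReal.ofReal C)
    {n : ℕ → ℕ} (hn : ∀ k, 0 < n k)
    (hlyap : Tendsto (fun k => lyapunovSum g p x (n k) / lyapunovSum g 2 x (n k) ^ (p / 2))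
      atTop (𝓝 0)) :
    TendstoInDistribution
      (fun k ω => linearNoise g ξ x (n k) ω / √(variance (linearNoise g ξ x (n k)) P))
      atTop (id : ℝ → ℝ) (fun _ => P) (gaussianReal 0 1) := by
  have hq2 : ∀ j, 1 ≤ j → MemLp (ξ j) 2 P := fun j hj => (hq j hj).mono_exponent (by
    rw [← ENNReal.ofReal_ofNat]; exact ENNReal.ofReal_le_ofReal hp.le)
  set v : ℕ → ℝ := fun k => variance (linearNoise g ξ x (n k)) P with hv
  have hvlow : ∀ k, c ^ 2 * lyapunovSum g 2 x (n k) ≤ v k := fun k =>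
    sq_mul_lyapunovSum_le_variance hc.le hq2 hindep hmean hlow (n k)
  have hΛ : ∀ k, 1 ≤ lyapunovSum g 2 x (n k) := fun k => one_le_lyapunovSum 2 (hn k)
  have hΛc : ∀ k, 0 < c ^ 2 * lyapunovSum g 2 x (n k) := fun k =>
    mul_pos (by positivity) (by linarith [hΛ k])
  have hvpos : ∀ k, 0 < v k := fun k => (hΛc k).trans_le (hvlow k)
  set d : ℕ → ℕ → ℝ := fun k i => deriv g^[n k - (i + 1)] (g^[i + 1] x) with hd
  set Y : ℕ → ℕ → Ω → ℝ := fun k i ω => (d k i / √(v k)) * ξ (i + 1) ω with hY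
  have hmain : TendstoInDistribution (fun k ω => ∑ i ∈ Finset.range (n k), Y k i ω)
      atTop (id : ℝ → ℝ) (fun _ => P) (gaussianReal 0 1) := by
    refine tendstoInDistribution_sum_of_lyapunov hp (fun k i => (hq _ (by omega)).const_mul _)
      (fun k => ?_) (fun k i => ?_) (fun k => ?_) ?_
    · exact hindep.comp (fun i y => (d k i / √(v k)) * y) fun i => measurable_const_mul _
    · rw [integral_const_mul, hmean _ (by omega), mul_zero]
    · have h1 := variance_linearNoise (g := g) (x := x) hq2 hindep hmean (n k)
      simp only [hY, mul_pow, integral_const_mul, div_pow, Real.sq_sqrt (hvpos k).le]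
      rw [← div_self (hvpos k).ne']
      conv_rhs => rw [hv]
      simp only [h1, Finset.sum_div]
      refine Finset.sum_congr rfl fun i _ => ?_
      simp only [hv, hd, h1]
      ring
    · have hb := hlyap.const_mul (C ^ p / c ^ p)
      rw [mul_zero] at hb
      refine squeeze_zero (fun k => Finset.sum_nonneg fun i _ =>
        integral_nonneg fun ω => by positivity) (fun k => ?_) hb
      have hsq : √(v k) ^ p = v k ^ (p / 2) := by
        rw [Real.sqrt_eq_rpow, ← Real.rpow_mul (hvpos k).le]
        congr 1
        ring
      have hvp : c ^ p * lyapunovSum g 2 x (n k) ^ (p / 2) ≤ v k ^ (p / 2) := by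
        have e : c ^ p * lyapunovSum g 2 x (n k) ^ (p / 2)
            = (c ^ 2 * lyapunovSum g 2 x (n k)) ^ (p / 2) := by
          rw [Real.mul_rpow (by positivity) (by linarith [hΛ k]), ← Real.rpow_two,
            ← Real.rpow_mul hc.le]
          congr 2
          ring
        rw [e]
        exact Real.rpow_le_rpow (hΛc k).le (hvlow k) (by linarith)
      have hpos : 0 < c ^ p * lyapunovSum g 2 x (n k) ^ (p / 2) :=
        mul_pos (Real.rpow_pos_of_pos hc _) (Real.rpow_pos_of_pos (by linarith [hΛ k]) _)
      calc ∑ i ∈ Finset.range (n k), ∫ ω, |Y k i ω| ^ p ∂P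
          ≤ ∑ i ∈ Finset.range (n k), |d k i| ^ p / v k ^ (p / 2) * C ^ p := by
            refine Finset.sum_le_sum fun i _ => ?_
            simp only [hY, abs_mul, abs_div, abs_of_nonneg (Real.sqrt_nonneg _),
              Real.mul_rpow (div_nonneg (abs_nonneg _) (Real.sqrt_nonneg _)) (abs_nonneg _),
              Real.div_rpow (abs_nonneg _) (Real.sqrt_nonneg _), hsq, integral_const_mul]
            refine mul_le_mul_of_nonneg_left ?_ (div_nonneg (by positivity)
              (Real.rpow_nonneg (hvpos k).le _))
            exact (hq _ (by omega)).integral_rpow_abs_le (by linarith) hC (hup _ (by omega))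
        _ = lyapunovSum g p x (n k) * C ^ p / v k ^ (p / 2) := by
            rw [lyapunovSum, sum_Icc_one_eq_sum_range, Finset.sum_mul, Finset.sum_div]
            refine Finset.sum_congr rfl fun i _ => ?_
            ring
        _ ≤ lyapunovSum g p x (n k) * C ^ p / (c ^ p * lyapunovSum g 2 x (n k) ^ (p / 2)) := by
            have h1 := one_le_lyapunovSum (g := g) (x := x) p (hn k)
            exact div_le_div_of_nonneg_left (mul_nonneg (by linarith) (Real.rpow_nonneg hC _))
              hpos hvp
        _ = C ^ p / c ^ p * (lyapunovSum g p x (n k) / lyapunovSum g 2 x (n k) ^ (p / 2)) := by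
            rw [mul_comm (lyapunovSum g p x (n k)), mul_div_mul_comm]
  refine hmain.congr (fun k => ae_of_all _ fun ω => ?_) (ae_of_all _ fun _ => rfl)
  simp only [hY]
  rw [linearNoise_eq_sum_range, Finset.sum_div]
  exact Finset.sum_congr rfl fun i _ => by ring

end Moments

/-! ### Outlier-free events and the effective noise. -/

section WeakNoise

variable {Ω : Type*} [MeasurableSpace Ω] {P : Measure Ω}
  {S : WeakNoiseMap} {ξ : ℕ → Ω → ℝ} {p x : ℝ} {n : ℕ → ℕ} {σ : ℕ → ℝ}

/-- Holds because `Λ̂ ≥ 1`; it reduces the exponent 6 to 3. -/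
theorem WeakNoiseMap.WeakNoise.mono {q r : ℕ} (hqr : q ≤ r) (hσ : ∀ k, 0 < σ k)
    (h : S.WeakNoise P ξ p x n σ r) : S.WeakNoise P ξ p x n σ q := by
  refine tendsto_of_tendsto_of_tendsto_of_le_of_le tendsto_const_nhds h (fun k => zero_le)
    fun k => ?_
  refine mul_le_mul_right (ENNReal.ofReal_le_ofReal ?_) _
  have := (hσ k).le
  have := pow_le_pow_right₀ (one_le_lyapunovHat (g := S.coord) (x := x) (n k)) hqr
  gcongr

theorem WeakNoiseMap.measurableSet_admissible (hmeas : ∀ j, 1 ≤ j → Measurable (ξ j)) (s : ℝ)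
    (N : ℕ) : MeasurableSet (S.admissible ξ s N) := by
  cases S with
  | line f smooth => exact MeasurableSet.univ
  | circle f F smooth lifts => exact MeasurableSet.univ
  | interval f a a_pos smooth maps =>
    exact measurableSet_le ((measurable_noiseMax hmeas N).const_mul s) measurable_const

/-- For a null sequence `q` there are divergent levels `T` with `T² q → 0`. -/
theorem exists_tendsto_atTop_sq_mul_tendsto_zero {q : ℕ → ℝ} (hq0 : ∀ k, 0 ≤ q k)
    (hq : Tendsto q atTop (𝓝 0)) :
    ∃ T : ℕ → ℝ, (∀ k, 0 < T k) ∧ Tendsto T atTop atTop ∧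
      Tendsto (fun k => T k ^ 2 * q k) atTop (𝓝 0) := by
  -- The added null sequence makes `e` positive where `q` vanishes; then `T = e^{-1/4}` satisfies
  -- `T² q ≤ √e`.
  set e : ℕ → ℝ := fun k => q k + 1 / ((k : ℝ) + 1) with he
  have hepos : ∀ k, 0 < e k := fun k => add_pos_of_nonneg_of_pos (hq0 k) (by positivity)
  have hlim : Tendsto e atTop (𝓝 0) := by
    simpa only [add_zero] using hq.add (tendsto_one_div_add_atTop_nhds_zero_nat (𝕜 := ℝ))
  have hs : Tendsto (fun k => √(e k)) atTop (𝓝 0) := by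
    simpa using hlim.sqrt
  have hss : Tendsto (fun k => √√(e k)) atTop (𝓝 0) := by
    simpa using hs.sqrt
  have hsspos : ∀ k, 0 < √√(e k) := fun k => Real.sqrt_pos.2 (Real.sqrt_pos.2 (hepos k))
  refine ⟨fun k => (√√(e k))⁻¹, fun k => inv_pos.2 (hsspos k), ?_, ?_⟩
  · exact tendsto_inv_nhdsGT_zero.comp (tendsto_nhdsWithin_iff.2
      ⟨hss, Eventually.of_forall fun k => hsspos k⟩)
  · refine squeeze_zero (fun k => mul_nonneg (sq_nonneg _) (hq0 k)) (fun k => ?_) hs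
    rw [inv_pow, Real.sq_sqrt (Real.sqrt_nonneg _), inv_mul_le_iff₀ (Real.sqrt_pos.2 (hepos k)),
      Real.mul_self_sqrt (hepos k).le]
    exact le_add_of_nonneg_right (by positivity)

variable [IsProbabilityMeasure P]

/-- Outlier-free events on which the noisy orbit is close to its linearization. -/
theorem WeakNoiseMap.exists_outlier_free_events {c : ℝ} (hc : 0 < c)
    (hmeas : ∀ j, 1 ≤ j → Measurable (ξ j)) (hp : 0 < p)
    (hq : ∀ j, 1 ≤ j → MemLp (ξ j) (ENNReal.ofReal p) P)
    (hlow : ENNReal.ofReal c ≤ eLpNorm (ξ 1) (ENNReal.ofReal p) P)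
    (hx : x ∈ S.space) (hn : ∀ k, 0 < n k)
    (hlyap : Tendsto (fun k => lyapunovSum S.coord p x (n k)
      / lyapunovSum S.coord 2 x (n k) ^ (p / 2)) atTop (𝓝 0))
    (hσ : ∀ k, 0 < σ k) (hweak : S.WeakNoise P ξ p x n σ 3) :
    ∃ (B : ℕ → Set Ω) (ε : ℕ → ℝ), (∀ k, MeasurableSet (B k)) ∧
      (∀ k, B k ⊆ S.admissible ξ (σ k) (n k)) ∧ Tendsto (fun k => P (B k)) atTop (𝓝 1) ∧
      Tendsto ε atTop (𝓝 0) ∧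
      (∀ᶠ k in atTop, ∀ ω ∈ B k, |noisyOrbit S.coord (σ k) (fun j => ξ j ω) x (n k)
        - S.coord^[n k] x - σ k * linearNoise S.coord ξ x (n k) ω|
        ≤ ε k * (σ k * √(lyapunovSum S.coord 2 x (n k)))) ∧
      ((∃ K : Set ℝ, IsCompact K ∧ ∀ j, 1 ≤ j → ∀ᵐ ω ∂P, ξ j ω ∈ K) →
        ∀ᶠ k in atTop, ∀ᵐ ω ∂P, ω ∈ B k) := by
  set m : ℕ → ℝ := fun k => (eLpNorm (noiseMax ξ (n k)) (ENNReal.ofReal p) P).toReal with hm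
  have hfin : ∀ k, eLpNorm (noiseMax ξ (n k)) (ENNReal.ofReal p) P ≠ ⊤ := fun k =>
    (memLp_noiseMax hmeas hq (n k)).2.ne
  have hme : ∀ k, eLpNorm (noiseMax ξ (n k)) (ENNReal.ofReal p) P = ENNReal.ofReal (m k) :=
    fun k => (ENNReal.ofReal_toReal (hfin k)).symm
  have hcm : ∀ k, c ≤ m k := fun k => by
    rw [hm, ← ENNReal.ofReal_le_iff_le_toReal (hfin k)]
    exact hlow.trans (eLpNorm_one_le_noiseMax (hn k))
  have hmpos : ∀ k, 0 < m k := fun k => hc.trans_le (hcm k)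
  set A : ℕ → ℝ := fun k => lyapunovHat S.coord x (n k) with hA
  set V : ℕ → ℝ := fun k => √(lyapunovSum S.coord 2 x (n k)) with hV
  have hA1 : ∀ k, 1 ≤ A k := fun k => one_le_lyapunovHat (n k)
  have hVA : ∀ k, V k ≤ A k := fun k => sqrt_lyapunovSum_two_le (n k)
  have hVpos : ∀ k, 0 < V k := fun k => Real.sqrt_pos.2 (one_pos.trans_le (one_le_lyapunovSum 2 (hn k)))
  have hfac : ∀ k, 0 < A k ^ 3 * σ k / V k := fun k =>
    div_pos (mul_pos (pow_pos (one_pos.trans_le (hA1 k)) 3) (hσ k)) (hVpos k)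
  -- All other factors of the weak noise quantity are positive, so an infinite supremum would make
  -- it infinite for every `k`.
  have hsup : S.secondDerivSup ≠ ⊤ := by
    intro htop
    obtain ⟨k, hk⟩ := (hweak.eventually_lt_const ENNReal.zero_lt_top).exists
    refine hk.ne ?_
    rw [htop, hme, ENNReal.top_mul, ENNReal.top_mul]
    · exact (ENNReal.ofReal_pos.2 (hfac k)).ne'
    · exact pow_ne_zero _ (ENNReal.ofReal_pos.2 (hmpos k)).ne'
  set h := S.secondDerivSup.toReal with hh
  have hh0 : 0 ≤ h := ENNReal.toReal_nonneg
  set q : ℕ → ℝ := fun k => h * m k ^ 2 * (A k ^ 3 * σ k / V k) with hqdef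
  have hq0 : ∀ k, 0 ≤ q k := fun k => mul_nonneg (mul_nonneg hh0 (sq_nonneg _)) (hfac k).le
  have hqlim : Tendsto q atTop (𝓝 0) := by
    have h1 := (ENNReal.tendsto_toReal ENNReal.zero_ne_top).comp hweak
    refine h1.congr fun k => ?_
    simp only [Function.comp, ENNReal.toReal_mul, ENNReal.toReal_pow]
    rw [ENNReal.toReal_ofReal (hfac k).le]
  obtain ⟨T, hTpos, hTtop, hTq⟩ := exists_tendsto_atTop_sq_mul_tendsto_zero hq0 hqlim
  obtain ⟨H, b, κ, hH, hb, hκ, hlin⟩ := S.exists_linearization_bound ξ hsup hx hp hn hlyap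
  have hκ' : H ≤ |κ| * h := hκ.trans (mul_le_mul_of_nonneg_right (le_abs_self κ) hh0)
  -- The bootstrap condition is linear in the noise and has no `V`. It follows from the quadratic
  -- quantity by `V ≤ A`, `m ≥ c` and `T ≥ 1`.
  have hsmall : ∀ᶠ k in atTop, ∀ ω, noiseMax ξ (n k) ω ≤ T k * m k →
      H * A k ^ 2 * (σ k * noiseMax ξ (n k) ω) ≤ b := by
    have h1 := hTq.const_mul (|κ| / c)
    rw [mul_zero] at h1
    filter_upwards [h1.eventually_lt_const hb, hTtop.eventually_ge_atTop 1] with k hk hT1 ω hω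
    refine le_trans ?_ hk.le
    have hA0 : 0 < A k := one_pos.trans_le (hA1 k)
    have a1 : A k ^ 2 ≤ A k ^ 3 / V k := by
      rw [le_div_iff₀ (hVpos k), pow_succ _ 2]
      exact mul_le_mul_of_nonneg_left (hVA k) (by positivity)
    have a2 : T k * m k ≤ T k ^ 2 * m k ^ 2 / c := by
      rw [le_div_iff₀ hc]
      have b1 : T k ≤ T k ^ 2 := by nlinarith
      have b2 : m k * c ≤ m k ^ 2 := by nlinarith [hcm k, hmpos k]
      calc T k * m k * c = T k * (m k * c) := by ring
        _ ≤ T k ^ 2 * m k ^ 2 := mul_le_mul b1 b2 (mul_nonneg (hmpos k).le hc.le) (sq_nonneg _)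
    have := (hσ k).le
    calc H * A k ^ 2 * (σ k * noiseMax ξ (n k) ω)
        ≤ (|κ| * h) * (A k ^ 3 / V k) * (σ k * (T k ^ 2 * m k ^ 2 / c)) := by
          have := noiseMax_nonneg ξ (n k) ω
          have := (hVpos k).le
          gcongr
          exact hω.trans a2
      _ = |κ| / c * (T k ^ 2 * q k) := by
          simp only [hqdef]
          ring
  -- The noise bound implies admissibility only for large `k`; the intersection secures the
  -- inclusion for every `k`.
  refine ⟨fun k => {ω | noiseMax ξ (n k) ω ≤ T k * m k} ∩ S.admissible ξ (σ k) (n k),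
    fun k => 4 * |κ| * (T k ^ 2 * q k), fun k => ?_, fun k => Set.inter_subset_right, ?_, ?_, ?_, ?_⟩
  · exact (measurableSet_le (measurable_noiseMax hmeas _) measurable_const).inter
      (measurableSet_admissible hmeas _ _)
  · have hinv : Tendsto (fun k => ENNReal.ofReal (T k)⁻¹ ^ p) atTop (𝓝 0) := by
      have h1 : Tendsto (fun k => ENNReal.ofReal (T k)⁻¹) atTop (𝓝 0) := by
        simpa using ENNReal.tendsto_ofReal (tendsto_inv_atTop_zero.comp hTtop)
      have h2 := ((ENNReal.continuous_rpow_const (y := p)).tendsto 0).comp h1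
      rwa [ENNReal.zero_rpow_of_pos hp] at h2
    have hlow1 : Tendsto (fun k => 1 - ENNReal.ofReal (T k)⁻¹ ^ p) atTop (𝓝 1) := by
      simpa using ENNReal.Tendsto.sub (tendsto_const_nhds (x := (1 : ENNReal))) hinv
        (Or.inl ENNReal.one_ne_top)
    refine tendsto_of_tendsto_of_tendsto_of_le_of_le' hlow1 tendsto_const_nhds ?_
      (Eventually.of_forall fun k => prob_le_one)
    filter_upwards [hsmall] with k hk
    have hsub : {ω | T k * m k < noiseMax ξ (n k) ω}ᶜ
        ⊆ {ω | noiseMax ξ (n k) ω ≤ T k * m k} ∩ S.admissible ξ (σ k) (n k) := by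
      intro ω hω
      have hω' : noiseMax ξ (n k) ω ≤ T k * m k := not_lt.1 hω
      exact ⟨hω', (hlin (σ k) (n k) ω (hσ k).le (hk ω hω')).1⟩
    refine le_trans ?_ (measure_mono hsub)
    rw [prob_compl_eq_one_sub (measurableSet_lt measurable_const (measurable_noiseMax hmeas _))]
    exact tsub_le_tsub_left (measure_lt_noiseMax_le hmeas hp (hmpos k) (hTpos k) (hme k)) _
  · simpa using hTq.const_mul (4 * |κ|)
  · filter_upwards [hsmall] with k hk ω hω
    refine (hlin (σ k) (n k) ω (hσ k).le (hk ω hω.1)).2.trans ?_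
    have h0 := noiseMax_nonneg ξ (n k) ω
    have hω1 : noiseMax ξ (n k) ω ≤ T k * m k := hω.1
    have := (hσ k).le
    have hA0 : 0 < A k := one_pos.trans_le (hA1 k)
    calc 4 * H * A k ^ 3 * (σ k * noiseMax ξ (n k) ω) ^ 2
        ≤ 4 * (|κ| * h) * A k ^ 3 * (σ k * (T k * m k)) ^ 2 := by gcongr
      _ = 4 * |κ| * (T k ^ 2 * q k) * (σ k * V k) := by
          simp only [hqdef]
          have := (hVpos k).ne'
          field_simp
  · rintro ⟨K, hK, hξK⟩
    obtain ⟨R, hR⟩ := hK.isBounded.exists_norm_le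
    filter_upwards [hsmall, hTtop.eventually_ge_atTop (|R| / c)] with k hk hTk
    filter_upwards [ae_all_iff.2 fun j => ae_all_iff.2 fun hj => hξK j hj] with ω hω
    -- Bounded noise is eventually below `T k * c`, so the events end up with full measure.
    have hle : noiseMax ξ (n k) ω ≤ T k * m k := by
      refine ((noiseMax_le_iff (abs_nonneg R)).2 fun j hj _ =>
        (hR _ (hω j hj)).trans (le_abs_self R)).trans ?_
      rw [div_le_iff₀ hc] at hTk
      exact hTk.trans (mul_le_mul_of_nonneg_left (hcm k) (hTpos k).le)
    exact ⟨hle, (hlin (σ k) (n k) ω (hσ k).le (hk ω hle)).1⟩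

/-- Admissibility and closeness are asked only almost surely and for large `k`, so that the
statement applies both to the outlier-free events and, for compactly supported noise, to the whole
space. -/
theorem WeakNoiseMap.effectiveNoiseCLT_of_ae_close {c : ℝ} (hc : 0 < c)
    (hq : ∀ j, 1 ≤ j → MemLp (ξ j) 2 P) (hindep : iIndepFun (fun j : ℕ => ξ (j + 1)) P)
    (hmean : ∀ j, 1 ≤ j → ∫ ω, ξ j ω ∂P = 0)
    (hlow : ∀ j, 1 ≤ j → ENNReal.ofReal c ≤ eLpNorm (ξ j) 2 P) (hn : ∀ k, 0 < n k)
    (hclt : TendstoInDistribution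
      (fun k ω => linearNoise S.coord ξ x (n k) ω / √(variance (linearNoise S.coord ξ x (n k)) P))
      atTop (id : ℝ → ℝ) (fun _ => P) (gaussianReal 0 1))
    (hσ : ∀ k, 0 < σ k) {B : ℕ → Set Ω} {ε : ℕ → ℝ} (hB : ∀ k, MeasurableSet (B k))
    (hPB : Tendsto (fun k => P (B k)) atTop (𝓝 1)) (hε : Tendsto ε atTop (𝓝 0))
    (hclose : ∀ᶠ k in atTop, ∀ᵐ ω ∂P, ω ∈ B k → ω ∈ S.admissible ξ (σ k) (n k) ∧
      |noisyOrbit S.coord (σ k) (fun j => ξ j ω) x (n k)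
        - S.coord^[n k] x - σ k * linearNoise S.coord ξ x (n k) ω|
        ≤ ε k * (σ k * √(lyapunovSum S.coord 2 x (n k)))) :
    S.EffectiveNoiseCLT P ξ x n σ B := by
  intro X hX
  set v : ℕ → ℝ := fun k => variance (linearNoise S.coord ξ x (n k)) P with hv
  have hVpos : ∀ k, 0 < √(lyapunovSum S.coord 2 x (n k)) := fun k =>
    Real.sqrt_pos.2 (one_pos.trans_le (one_le_lyapunovSum 2 (hn k)))
  -- Passes from the normalization by `√Λ₂` in the error bound to the standard deviation of the
  -- linear noise, at the cost of `1 / c`.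
  have hVv : ∀ k, c * √(lyapunovSum S.coord 2 x (n k)) ≤ √(v k) := fun k => by
    have h1 := Real.sqrt_le_sqrt
      (sq_mul_lyapunovSum_le_variance (g := S.coord) (x := x) hc.le hq hindep hmean hlow (n k))
    rwa [Real.sqrt_mul (sq_nonneg c), Real.sqrt_sq hc.le] at h1
  have hspos : ∀ k, 0 < √(v k) := fun k => (mul_pos hc (hVpos k)).trans_le (hVv k)
  have hmem : ∀ k, MemLp (linearNoise S.coord ξ x (n k)) 2 P := fun k => memLp_linearNoise hq (n k)
  have hl2 : ∀ k, MemLp (fun ω => linearNoise S.coord ξ x (n k) ω / √(v k)) 2 P := fun k => by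
    simpa only [div_eq_inv_mul] using (hmem k).const_mul (√(v k))⁻¹
  have hl0 : ∀ k, ∫ ω, linearNoise S.coord ξ x (n k) ω / √(v k) ∂P = 0 := fun k => by
    rw [integral_div, integral_linearNoise hq hmean, zero_div]
  have hl1 : ∀ k, ∫ ω, (linearNoise S.coord ξ x (n k) ω / √(v k)) ^ 2 ∂P = 1 := fun k => by
    have h1 : v k = ∫ ω, linearNoise S.coord ξ x (n k) ω ^ 2 ∂P := by
      have h2 := variance_eq_sub (hmem k)
      rw [integral_linearNoise hq hmean] at h2
      simpa using h2
    have hvpos := Real.sqrt_pos.1 (hspos k)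
    simp only [div_pow, Real.sq_sqrt hvpos.le]
    rw [integral_div, ← h1, div_self hvpos.ne']
  set U : ℕ → Ω → ℝ := fun k ω => (X k ω - S.coord^[n k] x) / (σ k * √(v k)) with hU
  have hUm : ∀ k, AEMeasurable (U k) P := fun k => ((hX k).1.sub_const _).div_const _
  have hεc : Tendsto (fun k => |ε k| / c) atTop (𝓝 0) := by
    simpa using hε.abs.div_const c
  have hUl : ∀ᶠ k in atTop, ∀ᵐ ω ∂P, ω ∈ B k →
      |U k ω - linearNoise S.coord ξ x (n k) ω / √(v k)| ≤ |ε k| / c := by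
    filter_upwards [hclose] with k hk
    filter_upwards [hk] with ω hω hmB
    obtain ⟨hadm, hle⟩ := hω hmB
    have hs := hspos k
    have hσk := hσ k
    have e : U k ω - linearNoise S.coord ξ x (n k) ω / √(v k)
        = (X k ω - S.coord^[n k] x - σ k * linearNoise S.coord ξ x (n k) ω)
          / (σ k * √(v k)) := by
      simp only [hU]
      field_simp
    rw [e, abs_div, abs_of_pos (mul_pos hσk hs), (hX k).2 ω hadm,
      div_le_div_iff₀ (mul_pos hσk hs) hc]
    calc _ ≤ ε k * (σ k * √(lyapunovSum S.coord 2 x (n k))) * c :=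
          mul_le_mul_of_nonneg_right hle hc.le
      _ ≤ |ε k| * (σ k * √(lyapunovSum S.coord 2 x (n k))) * c := by
          have := hVpos k
          gcongr
          exact le_abs_self _
      _ = |ε k| * (σ k * (c * √(lyapunovSum S.coord 2 x (n k)))) := by ring
      _ ≤ |ε k| * (σ k * √(v k)) := by
          gcongr
          exact hVv k
  refine ⟨tendstoInDistribution_of_abs_sub_le hclt hUm hB hPB hεc hUl, ?_⟩
  refine (tendstoInDistribution_indicator_div_sqrt_variance hl2 hl0 hl1 hclt hUm hB hPB hεc
    hUl).congr (fun k => ae_of_all _ fun ω => ?_) (ae_of_all _ fun _ => rfl)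
  exact indicator_div_sqrt_variance_div P _ (B k) (mul_pos (hσ k) (hspos k)) ω

end WeakNoise

theorem theorem1 {Ω : Type*} [MeasurableSpace Ω] (P : Measure Ω) [IsProbabilityMeasure P]
    (S : WeakNoiseMap)
    (ξ : ℕ → Ω → ℝ) (hmeas : ∀ j, 1 ≤ j → Measurable (ξ j))
    (hindep : iIndepFun (fun j : ℕ => ξ (j + 1)) P)
    (p : ℝ) (hp : 2 < p)
    (hmean : ∀ j, 1 ≤ j → ∫ ω, ξ j ω ∂P = 0)
    (hmoments : ∃ c C : ℝ, 0 < c ∧ ∀ j, 1 ≤ j →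
      ENNReal.ofReal c ≤ eLpNorm (ξ j) 2 P ∧
      eLpNorm (ξ j) 2 P ≤ eLpNorm (ξ j) (ENNReal.ofReal p) P ∧
      eLpNorm (ξ j) (ENNReal.ofReal p) P ≤ ENNReal.ofReal C)
    (x : ℝ) (hx : x ∈ S.space)
    (n : ℕ → ℕ) (hn : StrictMono n) (hn_pos : ∀ k, 0 < n k)
    (hlyap : Tendsto (fun k => lyapunovSum S.coord p x (n k)
      / lyapunovSum S.coord 2 x (n k) ^ (p / 2)) atTop (𝓝 0))
    (σ : ℕ → ℝ) (hσ : ∀ k, 0 < σ k)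
    (hweak : S.WeakNoise P ξ p x n σ 6 ∨ (4 ≤ p ∧ S.WeakNoise P ξ p x n σ 3)) :
    (∃ B : ℕ → Set Ω,
      (∀ k, MeasurableSet (B k)) ∧
      (∀ k, B k ⊆ S.admissible ξ (σ k) (n k)) ∧
      Tendsto (fun k => P (B k)) atTop (𝓝 1) ∧
      S.EffectiveNoiseCLT P ξ x n σ B) ∧
    ((∃ K : Set ℝ, IsCompact K ∧ ∀ j, 1 ≤ j → ∀ᵐ ω ∂P, ξ j ω ∈ K) →
      S.EffectiveNoiseCLT P ξ x n σ (fun _ => Set.univ)) := by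
  obtain ⟨c, C, hc, hmom⟩ := hmoments
  have hC : 0 ≤ C := by
    obtain ⟨h1, h2, h3⟩ := hmom 1 le_rfl
    exact ((ENNReal.ofReal_pos.1 ((ENNReal.ofReal_pos.2 hc).trans_le (h1.trans (h2.trans h3)))).le)
  have hp0 : 0 < p := by linarith
  have hLp : ∀ j, 1 ≤ j → MemLp (ξ j) (ENNReal.ofReal p) P := fun j hj =>
    ⟨(hmeas j hj).aestronglyMeasurable, (hmom j hj).2.2.trans_lt ENNReal.ofReal_lt_top⟩
  have hL2 : ∀ j, 1 ≤ j → MemLp (ξ j) 2 P := fun j hj => (hLp j hj).mono_exponent (by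
    rw [← ENNReal.ofReal_ofNat]; exact ENNReal.ofReal_le_ofReal hp.le)
  have hlow : ∀ j, 1 ≤ j → ENNReal.ofReal c ≤ eLpNorm (ξ j) 2 P := fun j hj => (hmom j hj).1
  have hclt := tendstoInDistribution_linearNoise hp hc hC hLp hindep hmean hlow
    (fun j hj => (hmom j hj).2.2) hn_pos hlyap
  have hweak3 : S.WeakNoise P ξ p x n σ 3 := hweak.elim (·.mono (by norm_num) hσ) (·.2)
  obtain ⟨B, ε, hB, hBadm, hPB, hε, hclose, hcompact⟩ :=
    WeakNoiseMap.exists_outlier_free_events hc hmeas hp0 hLp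
      ((hmom 1 le_rfl).1.trans (hmom 1 le_rfl).2.1) hx hn_pos hlyap hσ hweak3
  refine ⟨⟨B, hB, hBadm, hPB, ?_⟩, fun hK => ?_⟩
  · refine WeakNoiseMap.effectiveNoiseCLT_of_ae_close hc hL2 hindep hmean hlow hn_pos hclt hσ hB
      hPB hε ?_
    filter_upwards [hclose] with k hk
    exact ae_of_all _ fun ω hω => ⟨hBadm k hω, hk ω hω⟩
  · refine WeakNoiseMap.effectiveNoiseCLT_of_ae_close hc hL2 hindep hmean hlow hn_pos hclt hσ
      (fun _ => MeasurableSet.univ) (by simp) hε ?_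
    filter_upwards [hclose, hcompact hK] with k hk hkB
    filter_upwards [hkB] with ω hω _
    exact ⟨hBadm k hω, hk ω hω⟩
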